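/- Let $\Gamma$ be a connected negative definite plumbing graph whose associated plumbed $3$-manifold is a rational homology sphere; that is, $\Gamma$ is a finite tree with vertex set $\mathcal V$, all genera are zero, and the intersection form $(\cdot,\cdot)$ on the lattice $L=\mathbb Z\langle E_v\rangle_{v\in\mathcal V}$ (Euler numbers on the diagonal, $(E_v,E_w)=1$ if $v\ne w$ are adjacent and $0$ otherwise) is negative definite. Let $E_v^*\in L\otimes\mathbb Q$ be defined by $(E_v^*,E_w)=-\delta_{vw}$, let $L'=\mathbb Z\langle E_v^*\rangle_{v\in\mathcal V}$ be the dual lattice and $H=L'/L$, with $[l']\in H$ the class of $l'\in L'$. Let $\delta_v$ be the valency of $v$, let $\mathcal N=\{n:\delta_n\ge 3\}$ be the set of nodes, assumed non-empty, and let $\Gamma^{orb}$ be the orbifold graph: its vertices are the nodes, and two nodes are joined by an edge if the path of $\Gamma$ connecting them has only vertices of valency $2$ in its interior. Let $\delta_{n,\mathcal N}$ be the valency of $n$ in $\Gamma^{orb}$. Write $\mathbf t^{l}=\prod_v t_v^{l_v}$ for $l=\sum_v l_vE_v$. Let $f(\mathbf t)=\prod_{v\in\mathcal V}(1-\mathbf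 t^{E_v^*})^{\delta_v-2}$ be the zeta function, with Taylor expansion $Z(\mathbf t)=\sum_{l'}p_{l'}\mathbf t^{l'}$ at the origin. For $h\in H$ let $f_h(\mathbf t)$ be the rational function with Taylor expansion $Z_h(\mathbf t)=\sum_{[l']=h}p_{l'}\mathbf t^{l'}$, and let $f_h(\mathbf t_{\mathcal N})=f_h(\mathbf t)|_{t_v=1,\,v\notin\mathcal N}$. For a non-empty $S\subseteq\mathcal N$ there is a unique decomposition $f_h(\mathbf t_{\mathcal N})=P^S_h(\mathbf t_{\mathcal N})+f^{S,neg}_h(\mathbf t_{\mathcal N})$ in which $P^S_h$ is a Laurent polynomial (in fractional powers of the variables) each of whose monomials $\mathbf t_{\mathcal N}^{\beta}=\prod_{n\in\mathcal N}t_n^{\beta_n}$ satisfies $\beta_n\ge 0$ for at least one $n\in S$, and $f^{S,neg}_h$ is a rational function with negative degree in $t_n$ for every $n\in S$. Put $P^+_h=P_h^{\mathcal N}$, $P^n_h=P_h^{\{n\}}$, $P^{n,n'}_h=P_h^{\{n,n'\}}$, and define the multivariable polynomial part $$P_h(\mathbf t_{\mathcal N})=\sum_{\overline{nn'}\text{ edge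 of }\Gamma^{orb}}P_h^{n,n'}(\mathbf t_{\mathcal N})-\sum_{n\in\mathcal N}(\delta_{n,\mathcal N}-1)P_h^n(\mathbf t_{\mathcal N}).$$ For a chosen node $n_0$, orient the edges of $\Gamma^{orb}$ towards $n_0$ and write $n>n'$ if there is an edge oriented from $n$ to $n'$. The multiplicity of $\beta$ is $\mathfrak s(\beta)=\mathfrak s_{n_0}(\beta)+\sum_{n>n'}\mathfrak s_{n>n'}(\beta)$, where $\mathfrak s_{n_0}(\beta)=1$ if $\beta_{n_0}\ge0$ and $0$ otherwise, and $\mathfrak s_{n>n'}(\beta)=1$ if $\beta_n\ge 0$ and $\beta_{n'}<0$, and $0$ otherwise. **Theorem.** If $\Gamma^{orb}$ is a bamboo, that is, none of its vertices has valency $\ge3$, then for every $h\in H$ one has $$P_h(\mathbf t_{\mathcal N})=P_h^+(\mathbf t_{\mathcal N}),$$ and $\mathfrak s(\beta)=1$ for every monomial $\mathbf t_{\mathcal N}^\beta$ of $P^+_h(\mathbf t_{\mathcal N})$ (for every choice of $n_0$). -/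

import Mathlib

noncomputable section

/-! ### Plumbing graphs and their lattices -/

open Classical in
/-- The intersection matrix `I = ((E_v, E_w))_{v,w}` of a decorated graph: the Euler numbers on
the diagonal, and `1` or `0` off the diagonal according to adjacency. -/
def intersectionMatrix {V : Type*} (G : SimpleGraph V) (euler : V → ℤ) : Matrix V V ℤ :=
  Matrix.of fun v w => if v = w then euler v else if G.Adj v w then 1 else 0

/-- A connected negative definite plumbing graph whose associated 3-manifold is a rational
homology sphere: a finite tree (all genera are zero) with an Euler number on each vertex, whose
intersection form is negative definite. -/
structure PlumbingTree (V : Type*) [Fintype V] where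
  /-- the underlying graph -/
  graph : SimpleGraph V
  isTree : graph.IsTree
  /-- the self-intersection numbers `(E_v, E_v)` -/
  euler : V → ℤ
  negDef : (-(intersectionMatrix graph euler).map (Int.cast : ℤ → ℝ)).PosDef

namespace PlumbingTree

variable {V : Type*} [Fintype V] [DecidableEq V] (Γ : PlumbingTree V)

open Classical in
/-- The valency `δ_v`. -/
def valency (v : V) : ℕ := Γ.graph.degree v

/-- The set `𝒩` of nodes: the vertices of valency at least three. -/
abbrev Node : Type _ := {v : V // 3 ≤ Γ.valency v}

/-- The orbifold graph: its vertices are the nodes, and two different nodes are adjacent when the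
path of `Γ` that connects them has only vertices of valency two in its interior. -/
def orbGraph : SimpleGraph Γ.Node where
  Adj n m := n ≠ m ∧ ∃ p : Γ.graph.Walk n.1 m.1, p.IsPath ∧
    ∀ v ∈ p.support, v ≠ n.1 → v ≠ m.1 → Γ.valency v = 2
  symm := ⟨fun n m ⟨hne, p, hp, hv⟩ => ⟨hne.symm, p.reverse, hp.reverse, fun v hvp h₁ h₂ =>
    hv v (by simpa using hvp) h₂ h₁⟩⟩
  loopless := ⟨fun _ hn => hn.1 rfl⟩

open Classical in
/-- The valency `δ_{n,𝒩}` of a node in the orbifold graph. -/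
def orbValency (n : Γ.Node) : ℕ := Γ.orbGraph.degree n

/-- The orbifold graph is a bamboo: none of its vertices has valency three or more. -/
def OrbIsBamboo : Prop := ∀ n : Γ.Node, Γ.orbValency n < 3

/-- The (anti)dual class `E_v^* ∈ L ⊗ ℚ`, in coordinates with respect to the basis `(E_w)_w`;
it is determined by `(E_v^*, E_w) = -δ_{vw}`. -/
def dual (v : V) : V → ℚ :=
  fun w => -((intersectionMatrix Γ.graph Γ.euler).map (Int.cast : ℤ → ℚ))⁻¹ w v

/-- The dual lattice `L'`, generated by the classes `E_v^*`, inside `L ⊗ ℚ = ℚ^V`. -/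
def dualLattice : AddSubgroup (V → ℚ) := AddSubgroup.closure (Set.range Γ.dual)

/-- The lattice `L = ℤ^V` inside `L ⊗ ℚ = ℚ^V`. -/
def lattice (V : Type*) : AddSubgroup (V → ℚ) :=
  AddSubgroup.pi Set.univ fun _ => (Int.castAddHom ℚ).range

/-- The group `H = L'/L`. -/
abbrev H : Type _ := Γ.dualLattice ⧸ (lattice V).addSubgroupOf Γ.dualLattice

/-- The class `[∑_v k_v E_v^*] ∈ H`. -/
def classOf (k : V →₀ ℕ) : Γ.H :=
  QuotientAddGroup.mk (∑ v, k v • (⟨Γ.dual v, AddSubgroup.subset_closure ⟨v, rfl⟩⟩ : Γ.dualLattice))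

end PlumbingTree

/-! ### Rational functions with rational exponents and their polynomial parts -/

/-- Laurent polynomials in (fractional powers of) the variables `t_i`, `i ∈ ι`, with integral
coefficients; `AddMonoidAlgebra.single β 1` is the monomial `t^β = ∏_i t_i^{β_i}`. -/
abbrev LaurentPoly (ι : Type*) : Type _ := AddMonoidAlgebra ℤ (ι → ℚ)

/-- The field of rational functions in (fractional powers of) the variables `t_i`, `i ∈ ι`. -/
abbrev RatFun (ι : Type*) : Type _ := FractionRing (LaurentPoly ι)

/-- The degree of a Laurent polynomial in the variable `t_i` (it is `⊥` for the zero
polynomial). -/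
def degreeIn {ι : Type*} (i : ι) (P : LaurentPoly ι) : WithBot ℚ :=
  P.coeff.support.sup fun β => ((β i : ℚ) : WithBot ℚ)

/-- The rational function `F` has negative degree in the variable `t_i`. -/
def HasNegDegreeIn {ι : Type*} [Finite ι] (i : ι) (F : RatFun ι) : Prop :=
  ∃ B A : LaurentPoly ι, A ≠ 0 ∧
    F = algebraMap (LaurentPoly ι) (RatFun ι) B / algebraMap (LaurentPoly ι) (RatFun ι) A ∧
    degreeIn i B < degreeIn i A

/-- `F = P + F^neg` is the decomposition of `F` viewed as a function in the variables `t_i`,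
`i ∈ S`, the other variables being regarded as coefficients: each monomial `t^β` of the Laurent
polynomial `P` satisfies `β ≮ 0` in the coordinates of `S` (not all `β_i`, `i ∈ S`, are negative)
and `F^neg` has negative degree in `t_i` for every `i ∈ S`. -/
def IsPolyPart {ι : Type*} [Finite ι] (S : Set ι) (F : RatFun ι) (P : LaurentPoly ι) : Prop :=
  (∀ β ∈ P.coeff.support, ∃ i ∈ S, 0 ≤ β i) ∧
    ∀ i ∈ S, HasNegDegreeIn i (F - algebraMap (LaurentPoly ι) (RatFun ι) P)

open Classical in
/-- The Laurent polynomial `P` of the decomposition `F = P + F^neg` in the variables `t_i`,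
`i ∈ S`. -/
def polyPart {ι : Type*} [Finite ι] (S : Set ι) (F : RatFun ι) : LaurentPoly ι :=
  if hP : ∃ P, IsPolyPart S F P then hP.choose else 0

/-! ### The zeta function -/

/-- `1 - X_v` is an invertible power series. -/
theorem isUnit_one_sub_X {V : Type*} (v : V) :
    IsUnit (1 - MvPowerSeries.X v : MvPowerSeries V ℤ) := by
  rw [MvPowerSeries.isUnit_iff_constantCoeff]
  simp

namespace PlumbingTree

variable {V : Type*} [Fintype V] [DecidableEq V] (Γ : PlumbingTree V)

/-- The topological Poincaré series `Z(t)`, that is, the Taylor expansion of the zeta function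
`f(t) = ∏_v (1 - t^{E_v^*})^{δ_v - 2}`. It is supported on the semigroup freely generated by the
`E_v^*`, so it is written as a power series in the indeterminates `X_v = t^{E_v^*}`: the monomial
`X^k` stands for `t^{l'}` with `l' = ∑_v k_v E_v^*`. -/
def poincare : MvPowerSeries V ℤ :=
  ∏ v, (((isUnit_one_sub_X v).unit ^ ((Γ.valency v : ℤ) - 2) : (MvPowerSeries V ℤ)ˣ) :
    MvPowerSeries V ℤ)

open Classical in
/-- The `h`-part `Z_h(t)` of the Poincaré series: the sum of the terms of `Z(t)` with exponent
`l'` of class `[l'] = h`. -/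
def poincarePart (h : Γ.H) : MvPowerSeries V ℤ :=
  fun k => if Γ.classOf k = h then MvPowerSeries.coeff k Γ.poincare else 0

/-- The reduction of the variables to those of the nodes, `t_v = 1` for `v ∉ 𝒩`: the monomial
`X_v = t^{E_v^*}` is sent to `∏_{n ∈ 𝒩} t_n^{(E_v^*)_n}`. -/
def reduce : MvPolynomial V ℤ →ₐ[ℤ] LaurentPoly Γ.Node :=
  MvPolynomial.aeval fun v => AddMonoidAlgebra.single (fun n : Γ.Node => Γ.dual v n.1) 1

/-- `F` is the reduced zeta function `f_h(t_𝒩)`: the `h`-equivariant part `f_h(t)` of the zeta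
function is the rational function `p / q` whose Taylor expansion at the origin is `Z_h(t)`, and
`F` is its restriction to `t_v = 1`, `v ∉ 𝒩`. -/
def IsReducedZeta (h : Γ.H) (F : RatFun Γ.Node) : Prop :=
  ∃ p q : MvPolynomial V ℤ, MvPolynomial.constantCoeff q ≠ 0 ∧
    (q : MvPowerSeries V ℤ) * Γ.poincarePart h = (p : MvPowerSeries V ℤ) ∧
    F = algebraMap (LaurentPoly Γ.Node) (RatFun Γ.Node) (Γ.reduce p) /
      algebraMap (LaurentPoly Γ.Node) (RatFun Γ.Node) (Γ.reduce q)

open Classical in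
/-- The reduced zeta function `f_h(t_𝒩)`. -/
def reducedZeta (h : Γ.H) : RatFun Γ.Node :=
  if hF : ∃ F, Γ.IsReducedZeta h F then hF.choose else 0

/-- The quotient `P_h^+(t_𝒩)` of the multivariable division: the decomposition in all the
variables `t_n`, `n ∈ 𝒩`. -/
def quotientPart (h : Γ.H) : LaurentPoly Γ.Node :=
  polyPart Set.univ (Γ.reducedZeta h)

open Classical in
/-- The multivariable polynomial part
`P_h(t_𝒩) = ∑_{nn' edge of Γ^orb} P_h^{n,n'}(t_𝒩) - ∑_{n ∈ 𝒩} (δ_{n,𝒩} - 1) P_h^n(t_𝒩)`. -/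
def polynomialPart (h : Γ.H) : LaurentPoly Γ.Node :=
  ∑ e ∈ Γ.orbGraph.edgeFinset, polyPart {n | n ∈ e} (Γ.reducedZeta h) -
    ∑ n : Γ.Node, ((Γ.orbValency n : ℤ) - 1) • polyPart {n} (Γ.reducedZeta h)

/-- For the edges of the orbifold graph oriented towards `n₀`, there is an edge from `n` to `m`
(that is, `n > m`). -/
def OrbGT (n₀ n m : Γ.Node) : Prop :=
  Γ.orbGraph.Adj n m ∧ Γ.orbGraph.dist n n₀ = Γ.orbGraph.dist m n₀ + 1

open Classical in
/-- The multiplicity function `𝔰(β) = 𝔰_{n₀}(β) + ∑_{n > m} 𝔰_{n > m}(β)`. -/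
def multiplicity (n₀ : Γ.Node) (β : Γ.Node → ℚ) : ℕ :=
  (if 0 ≤ β n₀ then 1 else 0) +
    ∑ n : Γ.Node, ∑ m : Γ.Node, if Γ.OrbGT n₀ n m then (if 0 ≤ β n ∧ β m < 0 then 1 else 0) else 0

end PlumbingTree

end

noncomputable section

set_option linter.unusedSectionVars false

/-! ### Degrees of Laurent polynomials -/

section Support

variable {R G : Type*} [CommRing R] [AddCommMonoid G]

/-! One Laurent polynomial `P` computes all the decompositions at once.
`exists_hasNegDegreeIn_reducedZeta` gives a `P` such that `f_h - P` has negative degree in every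
variable. For each non-empty `S` the polynomial part is then the sum of the terms of `P` whose
exponent is non-negative at some node of `S` (`isPolyPart_filterTerms`, `polyPart_eq`). The
coefficients can therefore be compared exponent by exponent. With `A = {n | 0 ≤ β n}`, the
coefficient of `P` at `β` is multiplied in `P_h` by the number of edges of the orbifold graph that
touch `A`, minus `∑_{n ∈ A} (δ_{n,𝒩} - 1)`. In a tree this number is `1` as soon as `A` is non-empty
and connected (`card_edges_sub_sum`), and so is the multiplicity (`multiplicity_eq_one`).

It remains to see that `A` is connected for every exponent of `P`, which is where the geometry
enters. If `e` is a leaf at the node `n`, then `E_n^*` is a positive multiple of `E_e^*` modulo a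
class of `L` vanishing at the nodes. The numerator factor of a node of orbifold valency at least two
therefore absorbs the denominators of its leaves, and only the leaves at end nodes survive in the
denominator (`exists_isReducedZeta`). Expanding at infinity introduces powers of `t^{-E_e^*}` for
these leaves only. Hence every exponent of `P` is the restriction of a rational class `l` with `(l,
E_v) ≤ 0` except possibly at end nodes; this is `innerCone`.

By negative definiteness, each connected piece of `{l < 0}` contains a vertex with `(l, E_v) > 0`,
hence an end node (`exists_orbGraph_walk_of_neg`). So the negative nodes are joined to ends of the
orbifold graph through negative nodes. In a bamboo this forces the non-negative nodes to form an
interval (`preconnected_induce_nonneg`), the only place where the bamboo hypothesis is needed. -/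

theorem exists_of_mem_support_mul {A B : AddMonoidAlgebra R G} {g : G}
    (hg : g ∈ (A * B).coeff.support) :
    ∃ a ∈ A.coeff.support, ∃ b ∈ B.coeff.support, a + b = g := by
  classical
  exact Finset.mem_add.1 (AddMonoidAlgebra.support_coeff_mul_subset A B hg)

/-- The elements supported in an additive submonoid. -/
def supportedIn (R : Type*) [CommRing R] (Q : AddSubmonoid G) : Subring (AddMonoidAlgebra R G) where
  carrier := {A | ∀ g ∈ A.coeff.support, g ∈ Q}
  mul_mem' := by
    intro A B hA hB g hg
    obtain ⟨a, ha, b, hb, rfl⟩ := exists_of_mem_support_mul hg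
    exact Q.add_mem (hA a ha) (hB b hb)
  one_mem' := by
    intro g hg
    have := AddMonoidAlgebra.support_coeff_one_subset hg
    rw [Finset.mem_zero] at this
    exact this ▸ Q.zero_mem
  add_mem' := by
    classical
    intro A B hA hB g hg
    rcases Finset.mem_union.1 (Finsupp.support_add hg) with h | h
    exacts [hA g h, hB g h]
  zero_mem' := by
    intro g hg
    simp at hg
  neg_mem' := by
    intro A hA g hg
    exact hA g (by simpa using hg)

theorem single_mem_supportedIn {Q : AddSubmonoid G} {g : G} (hg : g ∈ Q) (r : R) :
    AddMonoidAlgebra.single g r ∈ supportedIn R Q := by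
  intro g' hg'
  have := Finsupp.support_single_subset hg'
  rw [Finset.mem_singleton] at this
  exact this ▸ hg

/-- The sum of the terms of `A` whose exponent satisfies `p`. -/
def filterTerms (p : G → Prop) [DecidablePred p] (A : AddMonoidAlgebra R G) :
    AddMonoidAlgebra R G :=
  AddMonoidAlgebra.ofCoeff (A.coeff.filter p)

theorem mem_support_filterTerms {p : G → Prop} [DecidablePred p] {A : AddMonoidAlgebra R G}
    {g : G} : g ∈ (filterTerms p A).coeff.support ↔ g ∈ A.coeff.support ∧ p g := by
  simp only [filterTerms]
  rw [Finsupp.support_filter, Finset.mem_filter]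

theorem coeff_filterTerms {p : G → Prop} [DecidablePred p] (A : AddMonoidAlgebra R G)
    (g : G) : (filterTerms p A).coeff g = if p g then A.coeff g else 0 := by
  simp only [filterTerms]
  rw [Finsupp.filter_apply]

theorem filterTerms_add_filterTerms_not (p : G → Prop) [DecidablePred p]
    (A : AddMonoidAlgebra R G) : filterTerms p A + filterTerms (fun g => ¬ p g) A = A := by
  apply AddMonoidAlgebra.ext
  exact Finsupp.ext fun g => by
    rw [AddMonoidAlgebra.coeff_add, Finsupp.add_apply, coeff_filterTerms, coeff_filterTerms]
    by_cases h : p g <;> simp [h]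

end Support

section Degree

variable {ι : Type*} (i : ι)

theorem le_degreeIn {P : LaurentPoly ι} {β : ι → ℚ} (hβ : β ∈ P.coeff.support) :
    ((β i : ℚ) : WithBot ℚ) ≤ degreeIn i P :=
  Finset.le_sup (f := fun β : ι → ℚ => ((β i : ℚ) : WithBot ℚ)) hβ

theorem degreeIn_lt_iff {P : LaurentPoly ι} {x : ℚ} :
    degreeIn i P < (x : WithBot ℚ) ↔ ∀ β ∈ P.coeff.support, β i < x := by
  unfold degreeIn
  rw [Finset.sup_lt_iff (WithBot.bot_lt_coe x)]
  simp

theorem exists_degreeIn_eq {P : LaurentPoly ι} (hP : P ≠ 0) :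
    ∃ β ∈ P.coeff.support, degreeIn i P = ((β i : ℚ) : WithBot ℚ) := by
  apply Finset.exists_mem_eq_sup
  rw [Finsupp.support_nonempty_iff]
  intro h
  exact hP (AddMonoidAlgebra.ext (by simpa using h))

theorem degreeIn_zero : degreeIn i (0 : LaurentPoly ι) = ⊥ := by
  simp [degreeIn]

theorem degreeIn_neg (P : LaurentPoly ι) : degreeIn i (-P) = degreeIn i P := by
  simp [degreeIn]

theorem degreeIn_add_lt {P P' : LaurentPoly ι} {x : WithBot ℚ} (h : degreeIn i P < x)
    (h' : degreeIn i P' < x) : degreeIn i (P + P') < x := by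
  classical
  have hx : ⊥ < x := bot_le.trans_lt h
  unfold degreeIn at *
  rw [Finset.sup_lt_iff hx] at *
  intro β hβ
  rcases Finset.mem_union.1 (Finsupp.support_add hβ) with hb | hb
  exacts [h β hb, h' β hb]

variable [Finite ι]

/-- The top parts of `A` and `B` with respect to `t_i` are non-zero Laurent polynomials. Their
product is non-zero because the ring is a domain, and nothing else reaches its degree. -/
theorem degreeIn_mul (A B : LaurentPoly ι) :
    degreeIn i (A * B) = degreeIn i A + degreeIn i B := by
  classical
  by_cases hA : A = 0
  · simp [hA, degreeIn_zero]
  by_cases hB : B = 0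
  · simp [hB, degreeIn_zero]
  obtain ⟨α, hα, hAα⟩ := exists_degreeIn_eq i hA
  obtain ⟨β, hβ, hBβ⟩ := exists_degreeIn_eq i hB
  rw [hAα, hBβ]
  apply le_antisymm
  · apply Finset.sup_le
    intro γ hγ
    obtain ⟨a, ha, b, hb, rfl⟩ := exists_of_mem_support_mul hγ
    rw [← hAα, ← hBβ]
    simp only [Pi.add_apply, WithBot.coe_add]
    exact add_le_add (le_degreeIn i ha) (le_degreeIn i hb)
  · set A₁ := filterTerms (fun g => g i = α i) A with hA₁
    set A₂ := filterTerms (fun g => ¬ g i = α i) A with hA₂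
    set B₁ := filterTerms (fun g => g i = β i) B with hB₁
    set B₂ := filterTerms (fun g => ¬ g i = β i) B with hB₂
    have hsA : A₁ + A₂ = A := filterTerms_add_filterTerms_not _ A
    have hsB : B₁ + B₂ = B := filterTerms_add_filterTerms_not _ B
    have leA : ∀ a ∈ A.coeff.support, a i ≤ α i := fun a ha => by
      have := le_degreeIn i ha
      rw [hAα] at this
      exact_mod_cast this
    have leB : ∀ b ∈ B.coeff.support, b i ≤ β i := fun b hb => by
      have := le_degreeIn i hb
      rw [hBβ] at this
      exact_mod_cast this
    have hA0 : A₁ ≠ 0 := fun h => by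
      have : α ∈ A₁.coeff.support := mem_support_filterTerms.2 ⟨hα, rfl⟩
      rw [h] at this
      simp at this
    have hB0 : B₁ ≠ 0 := fun h => by
      have : β ∈ B₁.coeff.support := mem_support_filterTerms.2 ⟨hβ, rfl⟩
      rw [h] at this
      simp at this
    -- `γ` is any exponent of the product of the top parts. The other products only have exponents
    -- with smaller `i`-th coordinate, so the term at `γ` cannot cancel.
    obtain ⟨γ, hγ, -⟩ := exists_degreeIn_eq i (mul_ne_zero hA0 hB0)
    have hγi : γ i = α i + β i := by
      obtain ⟨a, ha, b, hb, rfl⟩ := exists_of_mem_support_mul hγ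
      rw [Pi.add_apply, (mem_support_filterTerms.1 ha).2, (mem_support_filterTerms.1 hb).2]
    have hAB : A * B = A₁ * B₁ + (A₁ * B₂ + A₂ * B) := by
      rw [← hsA, ← hsB]; ring
    have h₁ : (A₁ * B₂).coeff γ = 0 := by
      by_contra h
      obtain ⟨a, ha, b, hb, hab⟩ := exists_of_mem_support_mul (Finsupp.mem_support_iff.2 h)
      have h1 := (mem_support_filterTerms.1 ha).2
      obtain ⟨hb', hb''⟩ := mem_support_filterTerms.1 hb
      have h2 := lt_of_le_of_ne (leB b hb') hb''
      have : a i + b i = α i + β i := by rw [← hγi, ← hab]; rfl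
      linarith
    have h₂ : (A₂ * B).coeff γ = 0 := by
      by_contra h
      obtain ⟨a, ha, b, hb, hab⟩ := exists_of_mem_support_mul (Finsupp.mem_support_iff.2 h)
      obtain ⟨ha', ha''⟩ := mem_support_filterTerms.1 ha
      have h1 := lt_of_le_of_ne (leA a ha') ha''
      have h2 := leB b hb
      have : a i + b i = α i + β i := by rw [← hγi, ← hab]; rfl
      linarith
    have hmem : γ ∈ (A * B).coeff.support := by
      rw [Finsupp.mem_support_iff, hAB]
      simp only [AddMonoidAlgebra.coeff_add, Finsupp.add_apply, h₁, h₂, add_zero]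
      exact Finsupp.mem_support_iff.1 hγ
    have := le_degreeIn i hmem
    rwa [hγi] at this

-- Rational functions of negative degree in one variable

local notation "φ" => algebraMap (LaurentPoly ι) (RatFun ι)

theorem algebraMap_ratFun_ne_zero {A : LaurentPoly ι} (hA : A ≠ 0) : φ A ≠ 0 :=
  fun h => hA ((map_eq_zero_iff _ (IsFractionRing.injective (LaurentPoly ι) (RatFun ι))).1 h)

variable {i}

theorem degreeIn_ne_bot {A : LaurentPoly ι} (hA : A ≠ 0) : degreeIn i A ≠ ⊥ := by
  obtain ⟨β, -, h⟩ := exists_degreeIn_eq i hA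
  simp [h]

theorem degreeIn_mul_lt_mul {A B C D : LaurentPoly ι} (hD : D ≠ 0)
    (h : degreeIn i B < degreeIn i A) (h' : degreeIn i C ≤ degreeIn i D) :
    degreeIn i (B * C) < degreeIn i (A * D) := by
  rw [degreeIn_mul, degreeIn_mul]
  calc degreeIn i B + degreeIn i C ≤ degreeIn i B + degreeIn i D := by gcongr
    _ < degreeIn i A + degreeIn i D := WithBot.add_lt_add_right (degreeIn_ne_bot hD) h

theorem HasNegDegreeIn.add {F F' : RatFun ι} (h : HasNegDegreeIn i F) (h' : HasNegDegreeIn i F') :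
    HasNegDegreeIn i (F + F') := by
  obtain ⟨B, A, hA, rfl, hBA⟩ := h
  obtain ⟨B', A', hA', rfl, hBA'⟩ := h'
  refine ⟨B * A' + B' * A, A * A', mul_ne_zero hA hA', ?_, ?_⟩
  · rw [map_add, map_mul, map_mul, map_mul, div_add_div _ _ (algebraMap_ratFun_ne_zero hA)
      (algebraMap_ratFun_ne_zero hA')]
    ring
  · apply degreeIn_add_lt
    · exact degreeIn_mul_lt_mul hA' hBA le_rfl
    · rw [mul_comm A]
      exact degreeIn_mul_lt_mul hA hBA' le_rfl

theorem HasNegDegreeIn.neg {F : RatFun ι} (h : HasNegDegreeIn i F) : HasNegDegreeIn i (-F) := by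
  obtain ⟨B, A, hA, rfl, hBA⟩ := h
  exact ⟨-B, A, hA, by rw [map_neg, neg_div], by rwa [degreeIn_neg]⟩

theorem HasNegDegreeIn.div {F : RatFun ι} (h : HasNegDegreeIn i F) {D : LaurentPoly ι}
    (hD : 0 ≤ degreeIn i D) : HasNegDegreeIn i (F / φ D) := by
  have hD0 : D ≠ 0 := by
    rintro rfl
    simp [degreeIn_zero] at hD
  obtain ⟨B, A, hA, rfl, hBA⟩ := h
  refine ⟨B, A * D, mul_ne_zero hA hD0, by rw [map_mul, div_div], ?_⟩
  rw [degreeIn_mul]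
  calc degreeIn i B < degreeIn i A := hBA
    _ ≤ degreeIn i A + degreeIn i D := le_add_of_nonneg_right hD

theorem degreeIn_one : degreeIn i (1 : LaurentPoly ι) = 0 := by
  simp [degreeIn, AddMonoidAlgebra.support_coeff_one]

/-- Additivity of the degree makes negativity independent of the chosen fraction, so it can be
tested on the exponents themselves. -/
theorem hasNegDegreeIn_algebraMap_iff {P : LaurentPoly ι} :
    HasNegDegreeIn i (φ P) ↔ ∀ β ∈ P.coeff.support, β i < 0 := by
  constructor
  · rintro ⟨B, A, hA, h, hBA⟩
    rw [eq_div_iff (algebraMap_ratFun_ne_zero hA), ← map_mul] at h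
    have h := IsFractionRing.injective (LaurentPoly ι) (RatFun ι) h
    rw [← h, degreeIn_mul] at hBA
    have : degreeIn i P < ((0 : ℚ) : WithBot ℚ) := by
      by_contra hc
      push Not at hc
      exact absurd hBA (not_lt.2 (le_add_of_nonneg_left hc))
    exact (degreeIn_lt_iff i).1 this
  · intro h
    refine ⟨P, 1, one_ne_zero, by simp, ?_⟩
    rw [degreeIn_one]
    exact (degreeIn_lt_iff i).2 h

/-! ### Polynomial parts -/

/-- The difference of two candidates has negative degree in every `t_i`, `i ∈ S`, while each of its
exponents is non-negative somewhere on `S`; so it has no terms. -/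
theorem IsPolyPart.unique {S : Set ι} (hS : S.Nonempty) {F : RatFun ι} {P P' : LaurentPoly ι}
    (h : IsPolyPart S F P) (h' : IsPolyPart S F P') : P = P' := by
  classical
  obtain ⟨s, hs⟩ := hS
  have key : ∀ i ∈ S, ∀ β ∈ (P - P').coeff.support, β i < 0 := by
    intro i hi
    rw [← hasNegDegreeIn_algebraMap_iff]
    have := (h'.2 i hi).add (h.2 i hi).neg
    convert this using 1
    rw [map_sub]; ring
  by_contra hne
  obtain ⟨β, hβ, -⟩ := exists_degreeIn_eq s (sub_ne_zero.2 hne)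
  have : β ∈ P.coeff.support ∪ P'.coeff.support := Finsupp.support_sub hβ
  have : ∃ i ∈ S, 0 ≤ β i := by
    rcases Finset.mem_union.1 this with hb | hb
    exacts [h.1 β hb, h'.1 β hb]
  obtain ⟨i, hi, h0⟩ := this
  exact absurd (key i hi β hβ) (not_lt.2 h0)

theorem polyPart_eq {S : Set ι} (hS : S.Nonempty) {F : RatFun ι} {P : LaurentPoly ι}
    (h : IsPolyPart S F P) : polyPart S F = P := by
  have hex : ∃ P, IsPolyPart S F P := ⟨P, h⟩
  rw [polyPart, dif_pos hex]
  exact hex.choose_spec.unique hS h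

-- The discarded terms are negative in all the variables of `S`, so they can be moved to the
-- negative part. The same `P` thus serves for all `S`.
open Classical in
theorem isPolyPart_filterTerms {S : Set ι} {F : RatFun ι} {P : LaurentPoly ι}
    (h : ∀ i ∈ S, HasNegDegreeIn i (F - φ P)) :
    IsPolyPart S F (filterTerms (fun β => ∃ i ∈ S, 0 ≤ β i) P) := by
  refine ⟨fun β hβ => (mem_support_filterTerms.1 hβ).2, fun i hi => ?_⟩
  have h2 : HasNegDegreeIn i (φ (filterTerms (fun β => ¬ ∃ i ∈ S, 0 ≤ β i) P)) := by
    rw [hasNegDegreeIn_algebraMap_iff]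
    intro β hβ
    have := (mem_support_filterTerms.1 hβ).2
    push Not at this
    exact this i hi
  convert (h i hi).add h2 using 1
  have hP := congrArg φ (filterTerms_add_filterTerms_not (fun β => ∃ i ∈ S, 0 ≤ β i) P)
  rw [map_add] at hP
  linear_combination -hP

/-! ### Division by products of factors `1 - t^a` -/

/-- The polynomial `1 - t^a`. -/
def oneSub (a : ι → ℚ) : LaurentPoly ι := 1 - AddMonoidAlgebra.single a 1

theorem degreeIn_oneSub_nonneg {a : ι → ℚ} (ha : 0 < a i) : 0 ≤ degreeIn i (oneSub a) := by
  have : (0 : ι → ℚ) ∈ (oneSub a).coeff.support := by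
    have hne : a ≠ 0 := by rintro rfl; simp at ha
    rw [Finsupp.mem_support_iff, oneSub, AddMonoidAlgebra.coeff_sub, Finsupp.sub_apply,
      AddMonoidAlgebra.one_def]
    simp [hne]
  simpa using le_degreeIn i this

/-- Truncation of the expansion at infinity `1 / (1 - t^a) = -∑_{k ≥ 1} t^{-ka}`. Only the exponents
of `B` and multiples of `-a` occur, which is why membership in `Q` is inherited. -/
theorem exists_hasNegDegreeIn_div_oneSub {Q : AddSubmonoid (ι → ℚ)} {a : ι → ℚ} (ha : ∀ i, 0 < a i)
    (haQ : -a ∈ Q) {B : LaurentPoly ι} (hB : B ∈ supportedIn ℤ Q) :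
    ∃ P ∈ supportedIn ℤ Q, ∀ i, HasNegDegreeIn i (φ B / φ (oneSub a) - φ P) := by
  obtain ⟨N, hN⟩ : ∃ N : ℕ, ∀ i, ∀ β ∈ B.coeff.support, β i - N * a i < 0 := by
    have : ∀ i, ∀ β ∈ B.coeff.support, ∃ N : ℕ, ∀ M ≥ N, β i - M * a i < 0 := by
      intro i β _
      obtain ⟨N, hN⟩ := exists_nat_gt (β i / a i)
      refine ⟨N, fun M hM => ?_⟩
      rw [div_lt_iff₀ (ha i)] at hN
      have : (N : ℚ) * a i ≤ M * a i :=
        mul_le_mul_of_nonneg_right (by exact_mod_cast hM) (ha i).le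
      linarith
    choose! N hN using this
    cases nonempty_fintype ι
    -- The double sum is merely a common upper bound for the finitely many thresholds.
    refine ⟨∑ i, ∑ β ∈ B.coeff.support, N i β, fun i β hβ => hN i β hβ _ ?_⟩
    calc N i β ≤ ∑ β ∈ B.coeff.support, N i β :=
          Finset.single_le_sum (f := fun β => N i β) (fun _ _ => Nat.zero_le _) hβ
      _ ≤ _ := Finset.single_le_sum (f := fun i => ∑ β ∈ B.coeff.support, N i β)
          (fun _ _ => Nat.zero_le _) (Finset.mem_univ i)
  set x : LaurentPoly ι := AddMonoidAlgebra.single (-a) 1 with hx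
  have hxQ : x ∈ supportedIn ℤ Q := single_mem_supportedIn haQ 1
  refine ⟨-(B * x * ∑ k ∈ Finset.range N, x ^ k), ?_, fun i => ?_⟩
  · exact neg_mem (mul_mem (mul_mem hB hxQ) (sum_mem fun k _ => pow_mem hxQ k))
  · have hD := degreeIn_oneSub_nonneg (ha i)
    have hD0 : oneSub a ≠ 0 := by
      intro h
      simp [h, degreeIn_zero] at hD
    have hax : AddMonoidAlgebra.single a 1 * x = (1 : LaurentPoly ι) := by
      rw [hx, AddMonoidAlgebra.single_mul_single, AddMonoidAlgebra.one_def]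
      simp
    -- With `x = t^{-a}` this makes the remainder equal to `B x^N / (1 - t^a)`; the choice of `N`
    -- makes `B x^N` negative in every variable.
    have hgeom : oneSub a * (x * ∑ k ∈ Finset.range N, x ^ k) = x ^ N - 1 := by
      rw [← mul_assoc, oneSub, sub_mul, hax, one_mul, ← neg_sub (1 : LaurentPoly ι) x, neg_mul,
        mul_neg_geom_sum]
      ring
    have hxN : HasNegDegreeIn i (φ (B * x ^ N)) := by
      rw [hasNegDegreeIn_algebraMap_iff]
      intro β hβ
      obtain ⟨b, hb, c, hc, rfl⟩ := exists_of_mem_support_mul hβ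
      have hc' : c = N • (-a) := by
        rw [hx, AddMonoidAlgebra.single_pow] at hc
        simpa using Finsupp.support_single_subset hc
      have := hN i b hb
      rw [hc', Pi.add_apply, Pi.smul_apply, Pi.neg_apply, nsmul_eq_mul]
      linarith
    convert hxN.div hD using 1
    have h0 := algebraMap_ratFun_ne_zero hD0
    rw [eq_div_iff h0, sub_mul, div_mul_cancel₀ _ h0, ← map_mul, ← map_sub]
    congr 1
    linear_combination B * hgeom

/-- One factor is divided out at a time: dividing a negative remainder by a further `1 - t^a` keeps
it negative. -/
theorem exists_hasNegDegreeIn_div_prod {κ : Type*} {Q : AddSubmonoid (ι → ℚ)} {a : κ → ι → ℚ}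
    (s : Finset κ) (ha : ∀ k ∈ s, ∀ i, 0 < a k i)
    (haQ : ∀ k ∈ s, -a k ∈ Q) {B : LaurentPoly ι} (hB : B ∈ supportedIn ℤ Q) :
    ∃ P ∈ supportedIn ℤ Q,
      ∀ i, HasNegDegreeIn i (φ B / φ (∏ k ∈ s, oneSub (a k)) - φ P) := by
  classical
  induction s using Finset.induction_on with
  | empty =>
    refine ⟨B, hB, fun i => ?_⟩
    have : HasNegDegreeIn i (φ 0) := by
      rw [hasNegDegreeIn_algebraMap_iff]
      intro β hβ
      simp at hβ
    simpa using this
  | insert k s hk ih =>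
    obtain ⟨P, hP, h⟩ := ih (fun k hk => ha k (Finset.mem_insert_of_mem hk))
      (fun k hk => haQ k (Finset.mem_insert_of_mem hk))
    obtain ⟨P', hP', h'⟩ := exists_hasNegDegreeIn_div_oneSub (ha k (Finset.mem_insert_self k s))
      (haQ k (Finset.mem_insert_self k s)) hP
    refine ⟨P', hP', fun i => ?_⟩
    convert ((h i).div (degreeIn_oneSub_nonneg (ha k (Finset.mem_insert_self k s) i))).add (h' i)
      using 1
    rw [Finset.prod_insert hk, map_mul, mul_comm, ← div_div]
    ring

end Degree

/-! ### Paths in trees -/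

namespace SimpleGraph

variable {V : Type*} {G : SimpleGraph V}

theorem Walk.IsPath.exists_adj_adj_of_interior {u w v : V} {p : G.Walk u w} (hp : p.IsPath)
    (hv : v ∈ p.support) (hu : v ≠ u) (hw : v ≠ w) :
    ∃ a ∈ p.support, ∃ b ∈ p.support, a ≠ b ∧ G.Adj v a ∧ G.Adj v b := by
  obtain ⟨q, r, hqr⟩ := Walk.mem_support_iff_exists_append.1 hv
  have hq : ¬ q.Nil := fun h => hu h.eq.symm
  have hr : ¬ r.Nil := fun h => hw h.eq
  subst hqr
  refine ⟨q.penultimate, ?_, r.snd, ?_, ?_, (q.adj_penultimate hq).symm, r.adj_snd hr⟩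
  · exact (Walk.mem_support_append_iff q r).2 (Or.inl (q.getVert_mem_support _))
  · exact (Walk.mem_support_append_iff q r).2 (Or.inr (r.getVert_mem_support _))
  · exact hp.ne_of_mem_support_of_append (r.adj_snd hr).ne' (q.getVert_mem_support _)
      (r.getVert_mem_support _)

variable [Fintype V] [DecidableRel G.Adj]

theorem two_le_degree_of_adj {v a b : V} (hab : a ≠ b) (ha : G.Adj v a) (hb : G.Adj v b) :
    2 ≤ G.degree v := by
  classical
  rw [← card_neighborFinset_eq_degree, ← Finset.card_pair hab]
  apply Finset.card_le_card
  intro x hx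
  rw [mem_neighborFinset]
  rcases Finset.mem_insert.1 hx with rfl | hx
  · exact ha
  · rw [Finset.mem_singleton.1 hx]; exact hb

theorem eq_or_eq_of_degree_le_two {v a b c : V} (h : G.degree v ≤ 2) (hab : a ≠ b)
    (ha : G.Adj v a) (hb : G.Adj v b) (hc : G.Adj v c) : c = a ∨ c = b := by
  classical
  by_contra! hne
  rw [← card_neighborFinset_eq_degree] at h
  have : ({a, b, c} : Finset V) ⊆ G.neighborFinset v := by
    intro x hx
    rw [mem_neighborFinset]
    simp only [Finset.mem_insert, Finset.mem_singleton] at hx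
    rcases hx with rfl | rfl | rfl <;> assumption
  have := (Finset.card_le_card this).trans h
  rw [Finset.card_eq_three.2 ⟨a, b, c, hab, hne.1.symm, hne.2.symm, rfl⟩] at this
  omega

/-- In a graph with valencies at most two, let `A` be a set of vertices such that each vertex
outside `A` is connected outside `A` to a vertex of valency at most one. Then every path with
ends in `A` stays in `A`. -/
theorem Walk.IsPath.support_subset_of_degree_le_two (hG : ∀ v, G.degree v ≤ 2) {A : Set V}
    (hA : ∀ v ∉ A, ∃ m, G.degree m ≤ 1 ∧ ∃ q : G.Walk v m, ∀ k ∈ q.support, k ∉ A)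
    {u w : V} (hu : u ∈ A) (hw : w ∈ A) {p : G.Walk u w} (hp : p.IsPath) :
    ∀ v ∈ p.support, v ∈ A := by
  intro v hv
  by_contra hvA
  obtain ⟨m, hm, q, hq⟩ := hA v hvA
  -- A walk outside `A` that starts on `p` cannot leave `p`: its vertices are interior to `p`, which
  -- already uses both of their neighbours. So `m` is interior to `p` and has valency at least two.
  have key : ∀ {x y : V} (q : G.Walk x y), (∀ k ∈ q.support, k ∉ A) → x ∈ p.support →
      y ∈ p.support := by
    intro x y q
    induction q with
    | nil => exact fun _ h => h
    | @cons x z y h q ih =>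
      intro hq hx
      apply ih fun k hk => hq k (by simp [hk])
      have hxA := hq x (by simp)
      obtain ⟨a, ha, b, hb, hab, hxa, hxb⟩ := hp.exists_adj_adj_of_interior hx
        (by rintro rfl; exact hxA hu) (by rintro rfl; exact hxA hw)
      rcases eq_or_eq_of_degree_le_two (hG x) hab hxa hxb h with rfl | rfl <;> assumption
  have hmA := hq m q.end_mem_support
  obtain ⟨a, -, b, -, hab, hma, hmb⟩ := hp.exists_adj_adj_of_interior (key q hq hv)
    (by rintro rfl; exact hmA hu) (by rintro rfl; exact hmA hw)
  have := two_le_degree_of_adj hab hma hmb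
  omega

end SimpleGraph

/-! ### The orbifold graph -/

namespace PlumbingTree

open SimpleGraph

variable {V : Type*} [Fintype V] [DecidableEq V] (Γ : PlumbingTree V)

/-- The path that connects `u` and `w` has only vertices of valency two in its interior. -/
def Linked (u w : V) : Prop :=
  ∃ p : Γ.graph.Walk u w, p.IsPath ∧ ∀ v ∈ p.support, v ≠ u → v ≠ w → Γ.valency v = 2

variable {Γ}

theorem Linked.symm {u w : V} (h : Γ.Linked u w) : Γ.Linked w u := by
  obtain ⟨p, hp, hv⟩ := h
  exact ⟨p.reverse, hp.reverse, fun v hvp h₁ h₂ => hv v (by simpa using hvp) h₂ h₁⟩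

theorem orbGraph_adj_iff {n m : Γ.Node} : Γ.orbGraph.Adj n m ↔ n ≠ m ∧ Γ.Linked n.1 m.1 := Iff.rfl

theorem two_le_valency_of_interior {u w v : V} {p : Γ.graph.Walk u w} (hp : p.IsPath)
    (hv : v ∈ p.support) (hu : v ≠ u) (hw : v ≠ w) : 2 ≤ Γ.valency v := by
  classical
  obtain ⟨a, -, b, -, hab, ha, hb⟩ := hp.exists_adj_adj_of_interior hv hu hw
  unfold valency
  convert two_le_degree_of_adj hab ha hb

theorem eq_or_eq_of_valency_eq_two {v a b c : V} (h : Γ.valency v = 2) (hab : a ≠ b)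
    (ha : Γ.graph.Adj v a) (hb : Γ.graph.Adj v b) (hc : Γ.graph.Adj v c) : c = a ∨ c = b := by
  classical
  refine eq_or_eq_of_degree_le_two (G := Γ.graph) ?_ hab ha hb hc
  unfold valency at h
  convert h.le

/-- A path through vertices of valency two is determined by its first step until it reaches a
vertex of another valency. -/
theorem end_eq_of_snd_eq {u w w' : V} {p : Γ.graph.Walk u w} {p' : Γ.graph.Walk u w'}
    (hp : p.IsPath) (hp' : p'.IsPath)
    (hv : ∀ v ∈ p.support, v ≠ u → v ≠ w → Γ.valency v = 2)
    (hv' : ∀ v ∈ p'.support, v ≠ u → v ≠ w' → Γ.valency v = 2)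
    (hw : Γ.valency w ≠ 2) (hw' : Γ.valency w' ≠ 2) (hn : ¬ p.Nil) (hn' : ¬ p'.Nil)
    (hs : p.snd = p'.snd) : w = w' := by
  induction p with
  | nil => simp at hn
  | @cons u x w h q ih =>
    cases p' with
    | nil => simp at hn'
    | @cons _ x' _ h' q' =>
      simp only [Walk.snd_cons] at hs
      subst hs
      rw [Walk.cons_isPath_iff] at hp hp'
      by_cases hxw : x = w
      · by_contra hne
        subst hxw
        exact hw (hv' x (by simp) h.ne' hne)
      · by_cases hxw' : x = w'
        · subst hxw'
          exact absurd (hv x (by simp) h.ne' hxw) hw'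
        · have hx := hv x (by simp) h.ne' hxw
          have hq : ¬ q.Nil := fun hq => hxw hq.eq
          have hq' : ¬ q'.Nil := fun hq => hxw' hq.eq
          have hu : u ≠ q.snd := fun hu => hp.2 (hu ▸ q.getVert_mem_support _)
          have hu' : u ≠ q'.snd := fun hu => hp'.2 (hu ▸ q'.getVert_mem_support _)
          refine ih hp.1 (p' := q') hp'.1 ?_ ?_ hw hq hq' ?_
          · intro v hvq hvx hvw
            refine hv v (by simp [hvq]) ?_ hvw
            rintro rfl
            exact hp.2 hvq
          · intro v hvq hvx hvw
            refine hv' v (by simp [hvq]) ?_ hvw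
            rintro rfl
            exact hp'.2 hvq
          -- Both continuations avoid `u`, and `x` has only one other neighbour.
          · rcases eq_or_eq_of_valency_eq_two hx hu h.symm (q.adj_snd hq) (q'.adj_snd hq')
              with h | h
            · exact absurd h.symm hu'
            · exact h.symm

/-- A walk to a node can be split at its first node. -/
theorem exists_append_first_node {u m : V} (p : Γ.graph.Walk u m) (hm : 3 ≤ Γ.valency m) :
    ∃ (n : Γ.Node) (p₁ : Γ.graph.Walk u n.1) (p₂ : Γ.graph.Walk n.1 m), p = p₁.append p₂ ∧
      ∀ v ∈ p₁.support, v ≠ n.1 → Γ.valency v < 3 := by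
  induction p with
  | nil => exact ⟨⟨_, hm⟩, .nil, .nil, rfl, by simp⟩
  | @cons u x m h q ih =>
    by_cases hu : 3 ≤ Γ.valency u
    · exact ⟨⟨u, hu⟩, .nil, .cons h q, rfl, by simp⟩
    · obtain ⟨n, p₁, p₂, hq, hv⟩ := ih hm
      refine ⟨n, .cons h p₁, p₂, by rw [hq]; rfl, ?_⟩
      intro v hvp hvn
      rw [Walk.support_cons, List.mem_cons] at hvp
      rcases hvp with rfl | hvp
      · omega
      · exact hv v hvp hvn

/-- The first node after the start of a path. -/
theorem exists_append_linked {u x m : V} (h : Γ.graph.Adj u x) {p : Γ.graph.Walk x m}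
    (hp : (Walk.cons h p).IsPath) (hm : 3 ≤ Γ.valency m) :
    ∃ (n : Γ.Node) (p₂ : Γ.graph.Walk n.1 m), n.1 ≠ u ∧ Γ.Linked u n.1 ∧ p₂.IsPath ∧
      p₂.length ≤ p.length ∧ ∀ v ∈ p₂.support, v ∈ p.support := by
  obtain ⟨n, p₁, p₂, rfl, hv⟩ := exists_append_first_node p hm
  have hu := (Walk.cons_isPath_iff _ _).1 hp
  have hp₁ : (Walk.cons h p₁).IsPath := by
    rw [Walk.cons_isPath_iff]
    exact ⟨hu.1.of_append_left, fun h => hu.2 ((Walk.mem_support_append_iff _ _).2 (Or.inl h))⟩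
  refine ⟨n, p₂, ?_, ⟨.cons h p₁, hp₁, ?_⟩, hu.1.of_append_right, ?_, ?_⟩
  · intro hn
    exact hu.2 ((Walk.mem_support_append_iff _ _).2 (Or.inl (hn ▸ p₁.end_mem_support)))
  · intro v hvp hvu hvn
    have h2 := two_le_valency_of_interior hp₁ hvp hvu hvn
    rw [Walk.support_cons, List.mem_cons] at hvp
    have := hv v (hvp.resolve_left hvu) hvn
    omega
  · rw [Walk.length_append]; omega
  · exact fun v hv => (Walk.mem_support_append_iff _ _).2 (Or.inr hv)

theorem exists_linked_node (hnode : Nonempty Γ.Node) {e : V} (he : Γ.valency e < 3) :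
    ∃ n : Γ.Node, Γ.Linked e n.1 := by
  obtain ⟨m, hm⟩ := hnode
  obtain ⟨p, hp⟩ := (Γ.isTree.connected e m).exists_isPath
  cases p with
  | nil => omega
  | cons h q =>
    obtain ⟨n, -, -, hl, -⟩ := exists_append_linked h hp hm
    exact ⟨n, hl⟩

/-- The first steps of the linking paths are distinct neighbours of `n`, by `end_eq_of_snd_eq`. -/
theorem card_linked_le (n : V) (S : Finset V)
    (hS : ∀ w ∈ S, w ≠ n ∧ Γ.valency w ≠ 2 ∧ Γ.Linked n w) : S.card ≤ Γ.valency n := by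
  classical
  have hl : ∀ w ∈ S, ∃ x, ∃ p : Γ.graph.Walk n w, p.snd = x ∧ p.IsPath ∧
      ∀ v ∈ p.support, v ≠ n → v ≠ w → Γ.valency v = 2 := fun w hw => by
    obtain ⟨p, hp⟩ := (hS w hw).2.2
    exact ⟨_, p, rfl, hp⟩
  choose! x hx using hl
  unfold valency
  rw [← card_neighborFinset_eq_degree]
  refine Finset.card_le_card_of_injOn x ?_ ?_
  · intro w hw
    obtain ⟨p, hs, -⟩ := hx w hw
    simp only [Finset.mem_coe, mem_neighborFinset]
    rw [← hs]
    exact p.adj_snd fun h => (hS w hw).1 h.eq.symm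
  · intro w hw w' hw' hxx
    obtain ⟨p, hs, hp, hv⟩ := hx w hw
    obtain ⟨p', hs', hp', hv'⟩ := hx w' hw'
    exact end_eq_of_snd_eq hp hp' hv hv' (hS w hw).2.1 (hS w' hw').2.1
      (fun h => (hS w hw).1 h.eq.symm) (fun h => (hS w' hw').1 h.eq.symm) (by rw [hs, hs', hxx])

/-- The leaves linked to a node and its neighbours in the orbifold graph lie in different
directions. -/
theorem card_leaves_add_orbValency_le (n : Γ.Node) (S : Finset V)
    (hS : ∀ w ∈ S, Γ.valency w = 1 ∧ Γ.Linked n.1 w) :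
    S.card + Γ.orbValency n ≤ Γ.valency n := by
  classical
  have h := card_linked_le (Γ := Γ) n.1
    (S ∪ (Γ.orbGraph.neighborFinset n).map (Function.Embedding.subtype _)) ?_
  · rw [Finset.card_union_of_disjoint, Finset.card_map, card_neighborFinset_eq_degree] at h
    · unfold orbValency
      convert h
    · rw [Finset.disjoint_left]
      intro w hw hw'
      obtain ⟨m, -, rfl⟩ := Finset.mem_map.1 hw'
      have h1 := (hS _ hw).1
      have h2 := m.2
      simp only [Function.Embedding.subtype_apply] at h1
      omega
  · intro w hw
    have h0 := n.2
    rcases Finset.mem_union.1 hw with hw | hw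
    · obtain ⟨h1, h2⟩ := hS w hw
      refine ⟨?_, by omega, h2⟩
      rintro rfl
      omega
    · obtain ⟨m, hm, rfl⟩ := Finset.mem_map.1 hw
      rw [mem_neighborFinset, orbGraph_adj_iff] at hm
      have h2 := m.2
      refine ⟨fun h => hm.1 (Subtype.ext h.symm), ?_, hm.2⟩
      simp only [Function.Embedding.subtype_apply]
      omega

/-- Successive nodes along the path are linked. The control of the support lets sign conditions
along `p` pass to the orbifold graph. The bound `N` only serves the induction. -/
theorem exists_orbGraph_walk (N : ℕ) {n m : Γ.Node} (p : Γ.graph.Walk n.1 m.1) (hp : p.IsPath)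
    (hN : p.length ≤ N) :
    ∃ q : Γ.orbGraph.Walk n m, ∀ k ∈ q.support, k.1 ∈ p.support := by
  induction N generalizing n with
  | zero =>
    have : n = m := Subtype.ext (Walk.eq_of_length_eq_zero (Nat.le_zero.1 hN))
    subst this
    exact ⟨.nil, by simp⟩
  | succ N ih =>
    obtain ⟨n, hn⟩ := n
    cases p with
    | nil => exact ⟨.nil, by simp⟩
    | cons h q =>
      obtain ⟨k, p₂, hk, hl, hp₂, hlen, hsub⟩ := exists_append_linked h hp m.2
      rw [Walk.length_cons] at hN
      obtain ⟨q', hq'⟩ := ih p₂ hp₂ (by omega)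
      refine ⟨.cons (orbGraph_adj_iff.2 ⟨fun h => hk (by rw [← h]), hl⟩) q', ?_⟩
      intro j hj
      rw [Walk.support_cons, List.mem_cons] at hj ⊢
      rcases hj with rfl | hj
      · exact Or.inl rfl
      · exact Or.inr (hsub _ (hq' j hj))

/-- Acyclicity holds because each edge is a bridge. If `n` and `m` stayed connected after deletion
of their edge, lifting that walk to `Γ` and returning along the tail of `p` would bypass the first
edge of `p`, a bridge of the tree `Γ`. -/
theorem orbGraph_isTree (hnode : Nonempty Γ.Node) : Γ.orbGraph.IsTree := by
  refine ⟨⟨fun n m => ?_⟩, ?_⟩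
  · obtain ⟨p, hp⟩ := (Γ.isTree.connected n.1 m.1).exists_isPath
    obtain ⟨q, -⟩ := exists_orbGraph_walk _ p hp le_rfl
    exact q.reachable
  · rw [isAcyclic_iff_forall_adj_isBridge]
    intro n m hnm
    obtain ⟨hne, p, hp, hv⟩ := hnm
    rw [isBridge_iff]
    rintro ⟨r⟩
    have hn : ¬ p.Nil := fun h => hne (Subtype.ext h.eq)
    have hb : Γ.graph.IsBridge s(n.1, p.snd) :=
      isAcyclic_iff_forall_adj_isBridge.1 Γ.isTree.isAcyclic (p.adj_snd hn)
    rw [isBridge_iff] at hb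
    set G' := Γ.graph.deleteEdges {s(n.1, p.snd)} with hG'
    have hreach : ∀ {a b : V} (q : Γ.graph.Walk a b), s(n.1, p.snd) ∉ q.edges → G'.Reachable a b :=
      fun q hq => (q.toDeleteEdge _ hq).reachable
    have hnode : ∀ j : Γ.Node, Γ.valency j.1 ≠ 2 := fun j => by have := j.2; omega
    -- A linking path from `n` that uses the first edge of `p` must begin with it, hence ends at
    -- `m`.
    have haux : ∀ k l : Γ.Node, k ≠ l → s(k, l) ≠ s(n, m) → ∀ q : Γ.graph.Walk k.1 l.1, q.IsPath →
        (∀ v ∈ q.support, v ≠ k.1 → v ≠ l.1 → Γ.valency v = 2) → n = k →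
        s(n.1, p.snd) ∉ q.edges := by
      intro k l hkl hne' q hq hqv hnk hmem
      subst hnk
      have hs := hq.eq_snd_of_mem_edges hmem
      have := end_eq_of_snd_eq hp hq hv hqv (hnode m) (hnode l) hn
        (fun h => hkl (Subtype.ext h.eq)) hs
      exact hne' (by rw [Subtype.ext this])
    have hstep : ∀ k l : Γ.Node, (Γ.orbGraph.deleteEdges {s(n, m)}).Adj k l →
        G'.Reachable k.1 l.1 := by
      intro k l hkl
      rw [deleteEdges_adj] at hkl
      obtain ⟨⟨hkl, q, hq, hqv⟩, hne'⟩ := hkl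
      rw [Set.mem_singleton_iff] at hne'
      apply hreach q
      intro hmem
      have hnq : n.1 ∈ q.support := q.fst_mem_support_of_mem_edges hmem
      by_cases hnk : n = k
      · exact haux k l hkl hne' q hq hqv hnk hmem
      · by_cases hnl : n = l
        · refine haux l k hkl.symm (by rwa [Sym2.eq_swap]) q.reverse hq.reverse ?_ hnl
            (by simpa using hmem)
          exact fun v hvp h₁ h₂ => hqv v (by simpa using hvp) h₂ h₁
        · exact hnode n (hqv n.1 hnq (fun h => hnk (Subtype.ext h)) fun h => hnl (Subtype.ext h))
    have hwalk : ∀ {k l : Γ.Node}, (Γ.orbGraph.deleteEdges {s(n, m)}).Walk k l →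
        G'.Reachable k.1 l.1 := by
      intro k l q
      induction q with
      | nil => exact Reachable.refl _
      | cons h q ih => exact (hstep _ _ h).trans ih
    refine hb ((hwalk r).trans (hreach p.tail ?_).symm)
    have hnt : n.1 ∉ p.tail.support := by
      have := hp
      rw [← Walk.cons_tail_eq p hn, Walk.cons_isPath_iff] at this
      exact this.2
    exact fun hmem => hnt (p.tail.fst_mem_support_of_mem_edges hmem)

end PlumbingTree

/-! ### The intersection form -/

namespace PlumbingTree

open SimpleGraph Matrix

variable {V : Type*} [Fintype V] [DecidableEq V] (Γ : PlumbingTree V)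

/-- The rational intersection matrix. -/
def ratMatrix : Matrix V V ℚ := (intersectionMatrix Γ.graph Γ.euler).map (Int.cast : ℤ → ℚ)

/-- The intersection number `(l, E_v)`. -/
def pairing (l : V → ℚ) (v : V) : ℚ := (Γ.ratMatrix *ᵥ l) v

theorem pairing_eq_sum (l : V → ℚ) (v : V) : Γ.pairing l v = ∑ w, Γ.ratMatrix v w * l w := rfl

theorem ratMatrix_apply (v w : V) :
    Γ.ratMatrix v w = ((intersectionMatrix Γ.graph Γ.euler v w : ℤ) : ℚ) := rfl

theorem intersectionMatrix_of_adj {v w : V} (h : Γ.graph.Adj v w) :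
    intersectionMatrix Γ.graph Γ.euler v w = 1 := by
  simp [intersectionMatrix, h.ne, h]

theorem intersectionMatrix_of_not_adj {v w : V} (hne : v ≠ w) (h : ¬ Γ.graph.Adj v w) :
    intersectionMatrix Γ.graph Γ.euler v w = 0 := by
  simp [intersectionMatrix, hne, h]

theorem intersectionMatrix_comm (v w : V) :
    intersectionMatrix Γ.graph Γ.euler v w = intersectionMatrix Γ.graph Γ.euler w v := by
  by_cases hvw : v = w
  · rw [hvw]
  · by_cases h : Γ.graph.Adj v w
    · rw [Γ.intersectionMatrix_of_adj h, Γ.intersectionMatrix_of_adj h.symm]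
    · rw [Γ.intersectionMatrix_of_not_adj hvw h,
        Γ.intersectionMatrix_of_not_adj (Ne.symm hvw) fun h' => h h'.symm]

theorem sum_mul_pairing_neg {l : V → ℚ} (hl : l ≠ 0) : ∑ v, l v * Γ.pairing l v < 0 := by
  have h := Γ.negDef.dotProduct_mulVec_pos (x := fun v => (l v : ℝ)) (by
    intro h
    apply hl
    ext v
    simpa using congrFun h v)
  rw [neg_mulVec, dotProduct_neg] at h
  have h2 : (star fun v => (l v : ℝ)) ⬝ᵥ
      ((intersectionMatrix Γ.graph Γ.euler).map (Int.cast : ℤ → ℝ) *ᵥ fun v => (l v : ℝ)) =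
      ((∑ v, l v * Γ.pairing l v : ℚ) : ℝ) := by
    simp [dotProduct, mulVec, pairing_eq_sum, ratMatrix_apply]
  rw [h2] at h
  have h3 : ((∑ v, l v * Γ.pairing l v : ℚ) : ℝ) < 0 := by linarith
  exact_mod_cast h3

theorem isUnit_det_ratMatrix : IsUnit Γ.ratMatrix.det := by
  rw [isUnit_iff_ne_zero]
  intro h
  obtain ⟨l, hl, h0⟩ := exists_mulVec_eq_zero_iff.2 h
  have := Γ.sum_mul_pairing_neg hl
  simp [pairing, h0] at this

theorem dual_eq (v w : V) : Γ.dual v w = -Γ.ratMatrix⁻¹ w v := rfl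

theorem pairing_dual (u v : V) : Γ.pairing (Γ.dual u) v = if v = u then -1 else 0 := by
  have h := congrFun (congrFun (mul_nonsing_inv _ Γ.isUnit_det_ratMatrix) v) u
  rw [mul_apply, one_apply] at h
  rw [pairing_eq_sum]
  simp only [dual_eq, mul_neg, Finset.sum_neg_distrib, h]
  split_ifs <;> simp

/-- The class `E_v`, written in the dual basis. -/
theorem sum_smul_dual (v : V) :
    ∑ w, intersectionMatrix Γ.graph Γ.euler v w • Γ.dual w = -Pi.single v 1 := by
  ext x
  have h := congrFun (congrFun (nonsing_inv_mul _ Γ.isUnit_det_ratMatrix) x) v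
  rw [mul_apply, one_apply] at h
  simp only [Finset.sum_apply, Pi.smul_apply, Pi.neg_apply, Pi.single_apply]
  rw [← h, ← Finset.sum_neg_distrib]
  refine Finset.sum_congr rfl fun w _ => ?_
  rw [ratMatrix_apply, intersectionMatrix_comm, dual_eq, zsmul_eq_mul, mul_neg, mul_comm]

/-- On a set of vertices where `l` is negative, and whose outer neighbours have non-negative
coordinates, some intersection number with `l` is positive. -/
theorem exists_pairing_pos {l : V → ℚ} {K : Set V} (hK : K.Nonempty) (hneg : ∀ v ∈ K, l v < 0)
    (hout : ∀ v ∈ K, ∀ w ∉ K, Γ.graph.Adj v w → 0 ≤ l w) : ∃ v ∈ K, 0 < Γ.pairing l v := by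
  classical
  by_contra! hle
  obtain ⟨u, hu⟩ := hK
  -- Let `l_K` be `l` cut off outside `K`. If `(l, E_v) ≤ 0` on `K`, then `(l_K, E_v) ≤ (l, E_v) ≤
  -- 0` there, as the omitted neighbours contribute non-negatively; so `(l_K, l_K) ≥ 0`, against
  -- negative definiteness.
  have h := Γ.sum_mul_pairing_neg (l := K.indicator l) (fun h => by
    have := congrFun h u
    rw [Set.indicator_of_mem hu] at this
    exact (hneg u hu).ne this)
  refine absurd h (not_lt.2 (Finset.sum_nonneg fun v _ => ?_))
  by_cases hv : v ∈ K
  · rw [Set.indicator_of_mem hv]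
    apply mul_nonneg_of_nonpos_of_nonpos (hneg v hv).le
    refine le_trans ?_ (hle v hv)
    rw [pairing_eq_sum, pairing_eq_sum]
    refine Finset.sum_le_sum fun w _ => ?_
    by_cases hw : w ∈ K
    · rw [Set.indicator_of_mem hw]
    · rw [Set.indicator_of_notMem hw, mul_zero, ratMatrix_apply]
      by_cases hadj : Γ.graph.Adj v w
      · rw [Γ.intersectionMatrix_of_adj hadj]
        simpa using hout v hv w hw hadj
      · rw [Γ.intersectionMatrix_of_not_adj (by rintro rfl; exact hw hv) hadj]
        simp
  · rw [Set.indicator_of_notMem hv, zero_mul]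

theorem dual_nonneg (u v : V) : 0 ≤ Γ.dual u v := by
  by_contra! h
  obtain ⟨w, -, hw⟩ := Γ.exists_pairing_pos (l := Γ.dual u) (K := {v | Γ.dual u v < 0}) ⟨v, h⟩
    (fun _ h => h) fun v _ w hw _ => not_lt.1 hw
  rw [pairing_dual] at hw
  split_ifs at hw <;> norm_num at hw

/-- A zero coordinate at `v` spreads to the neighbours, since `(E_u^*, E_v) ≤ 0` is then a sum of
non-negative coordinates. By connectedness `E_u^*` would vanish. -/
theorem dual_pos (u v : V) : 0 < Γ.dual u v := by
  by_contra! h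
  have h0 : Γ.dual u v = 0 := le_antisymm h (Γ.dual_nonneg u v)
  have hstep : ∀ v w, Γ.graph.Adj v w → Γ.dual u v = 0 → Γ.dual u w = 0 := by
    intro v w hvw hv
    by_contra hw
    have hw := lt_of_le_of_ne (Γ.dual_nonneg u w) (Ne.symm hw)
    have hp : Γ.pairing (Γ.dual u) v ≤ 0 := by
      rw [pairing_dual]
      split_ifs <;> norm_num
    rw [pairing_eq_sum] at hp
    refine absurd hp (not_le.2 (Finset.sum_pos' (fun x _ => ?_) ⟨w, Finset.mem_univ w, ?_⟩))
    · by_cases hvx : v = x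
      · rw [← hvx, hv, mul_zero]
      · rw [ratMatrix_apply]
        by_cases hadj : Γ.graph.Adj v x
        · rw [Γ.intersectionMatrix_of_adj hadj]
          simpa using Γ.dual_nonneg u x
        · rw [Γ.intersectionMatrix_of_not_adj hvx hadj]
          simp
    · rw [ratMatrix_apply, Γ.intersectionMatrix_of_adj hvw]
      simpa using hw
  have hall : ∀ w, Γ.dual u w = 0 := by
    intro w
    obtain ⟨p⟩ := Γ.isTree.connected v w
    clear h
    induction p with
    | nil => exact h0
    | cons h p ih => exact ih (hstep _ _ h h0)
  have := Γ.pairing_dual u u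
  rw [if_pos rfl, pairing_eq_sum] at this
  simp [hall] at this

/-! ### Leaves -/

/-- The classes in `L` with vanishing coordinates at the nodes. -/
def latticeOffNodes : AddSubgroup (V → ℚ) where
  carrier := {l | (∀ v, ∃ z : ℤ, (z : ℚ) = l v) ∧ ∀ n : Γ.Node, l n.1 = 0}
  add_mem' := by
    rintro a b ⟨ha, ha'⟩ ⟨hb, hb'⟩
    refine ⟨fun v => ?_, fun n => by simp [ha' n, hb' n]⟩
    obtain ⟨x, hx⟩ := ha v
    obtain ⟨y, hy⟩ := hb v
    exact ⟨x + y, by simp [hx, hy]⟩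
  zero_mem' := ⟨fun _ => ⟨0, by simp⟩, fun _ => rfl⟩
  neg_mem' := by
    rintro a ⟨ha, ha'⟩
    refine ⟨fun v => ?_, fun n => by simp [ha' n]⟩
    obtain ⟨x, hx⟩ := ha v
    exact ⟨-x, by simp [hx]⟩

variable {Γ}

/-- Modulo `M`, the class `E_v` vanishes because `v` is not a node. Its expression in the dual basis
can then be solved for `E_w^*`, whose coefficient is `1`. -/
theorem dual_mem_of_neighbors {M : AddSubgroup (V → ℚ)} (hM : Γ.latticeOffNodes ≤ M) {v w : V}
    (hv : Γ.valency v < 3) (hvw : Γ.graph.Adj v w) (hvM : Γ.dual v ∈ M)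
    (hu : ∀ u, Γ.graph.Adj v u → u ≠ w → Γ.dual u ∈ M) : Γ.dual w ∈ M := by
  have h := Γ.sum_smul_dual v
  rw [← Finset.add_sum_erase _ _ (Finset.mem_univ w), Γ.intersectionMatrix_of_adj hvw,
    one_smul, ← eq_sub_iff_add_eq] at h
  rw [h]
  apply M.sub_mem
  · apply M.neg_mem
    apply hM
    refine ⟨fun x => ⟨(Pi.single v 1 : V → ℤ) x, ?_⟩, fun n => ?_⟩
    · simp [Pi.single_apply]
    · rw [Pi.single_eq_of_ne]
      intro h
      have := n.2
      rw [h] at this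
      omega
  · refine M.sum_mem fun u hu' => ?_
    have huw := (Finset.mem_erase.1 hu').1
    by_cases hvu : v = u
    · exact M.zsmul_mem (hvu ▸ hvM) _
    · by_cases hadj : Γ.graph.Adj v u
      · exact M.zsmul_mem (hu u hadj huw) _
      · rw [Γ.intersectionMatrix_of_not_adj hvu hadj, zero_smul]
        exact M.zero_mem

theorem dual_mem_of_path {M : AddSubgroup (V → ℚ)} (hM : Γ.latticeOffNodes ≤ M) {u x w : V}
    (h : Γ.graph.Adj u x) {q : Γ.graph.Walk x w} (hp : (Walk.cons h q).IsPath)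
    (hv : ∀ v ∈ q.support, v ≠ w → Γ.valency v = 2) (hu : Γ.dual u ∈ M) (hx : Γ.dual x ∈ M) :
    Γ.dual w ∈ M := by
  induction q generalizing u with
  | nil => exact hx
  | @cons x y w h' q ih =>
    rw [Walk.cons_isPath_iff] at hp
    have hxw : x ≠ w := by
      rintro rfl
      exact ((Walk.cons_isPath_iff _ _).1 hp.1).2 q.end_mem_support
    have hx2 := hv x (by simp) hxw
    have huy : u ≠ y := by
      rintro rfl
      exact hp.2 (by simp)
    refine ih h' hp.1 (fun v hvq hvw => hv v (by simp [hvq]) hvw) hx ?_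
    refine dual_mem_of_neighbors hM (by omega) h' hx fun z hz hzy => ?_
    rcases eq_or_eq_of_valency_eq_two hx2 huy h.symm h' hz with rfl | rfl
    · exact hu
    · exact absurd rfl hzy

theorem eq_of_valency_eq_one {v a b : V} (h : Γ.valency v = 1) (ha : Γ.graph.Adj v a)
    (hb : Γ.graph.Adj v b) : a = b := by
  classical
  by_contra hne
  have := two_le_degree_of_adj hne ha hb
  unfold valency at h
  have h' : Γ.graph.degree v = 1 := by convert h
  omega

/-- For a leaf `e` at the node `n`, the class `E_n^*` is a positive multiple of `E_e^*`, up to a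
class in `L` that vanishes at the nodes. -/
theorem exists_sub_smul_dual_mem {e : V} {n : Γ.Node} (he : Γ.valency e = 1)
    (hen : Γ.Linked e n.1) :
    ∃ α : ℕ, 0 < α ∧ Γ.dual n.1 - α • Γ.dual e ∈ Γ.latticeOffNodes := by
  obtain ⟨α, hα⟩ : ∃ α : ℤ, Γ.dual n.1 - α • Γ.dual e ∈ Γ.latticeOffNodes := by
    -- Starting at the leaf and walking towards `n`, each relation `E_v ≡ 0` expresses the next dual
    -- class through the two preceding ones, hence as a multiple of `E_e^*`.
    set M := AddSubgroup.zmultiples (Γ.dual e) ⊔ Γ.latticeOffNodes with hM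
    have hle : Γ.latticeOffNodes ≤ M := le_sup_right
    have heM : Γ.dual e ∈ M :=
      (le_sup_left : _ ≤ M) (AddSubgroup.mem_zmultiples (Γ.dual e))
    have hnM : Γ.dual n.1 ∈ M := by
      obtain ⟨n, hn⟩ := n
      obtain ⟨p, hp, hv⟩ := hen
      cases p with
      | nil => exact heM
      | @cons _ x _ h q =>
        have hx : Γ.dual x ∈ M := dual_mem_of_neighbors hle (by omega) h heM fun u hu hux =>
          absurd (eq_of_valency_eq_one he hu h) hux
        refine dual_mem_of_path hle h hp (fun v hvq hvn => hv v (by simp [hvq]) ?_ hvn) heM hx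
        rintro rfl
        exact ((Walk.cons_isPath_iff _ _).1 hp).2 hvq
    obtain ⟨y, hy, z, hz, hyz⟩ := AddSubgroup.mem_sup.1 hnM
    obtain ⟨α, rfl⟩ := AddSubgroup.mem_zmultiples_iff.1 hy
    exact ⟨α, by rw [← hyz]; simpa using hz⟩
  have h := hα.2 n
  rw [Pi.sub_apply, Pi.smul_apply, zsmul_eq_mul] at h
  -- The coordinates at `n` of `E_n^*` and `E_e^*` are both positive.
  have hpos : 0 < α := by
    have h1 := Γ.dual_pos n.1 n.1
    have h2 := Γ.dual_pos e n.1
    have h3 : (0 : ℚ) < α * Γ.dual e n.1 := by linarith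
    exact_mod_cast pos_of_mul_pos_left h3 h2.le
  lift α to ℕ using hpos.le
  exact ⟨α, by exact_mod_cast hpos, by simpa using hα⟩

/-! ### The exponents -/

variable (Γ)

/-- The nodes of valency at most one in the orbifold graph. -/
def IsEndNode (v : V) : Prop := ∃ h : 3 ≤ Γ.valency v, Γ.orbValency ⟨v, h⟩ ≤ 1

/-- The restrictions to the nodes of the rational classes that have non-positive intersection
with `E_v` for all vertices `v` other than the end nodes. -/
def innerCone : AddSubmonoid (Γ.Node → ℚ) where
  carrier := {β | ∃ l : V → ℚ, (∀ n : Γ.Node, β n = l n.1) ∧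
    ∀ v, ¬ Γ.IsEndNode v → Γ.pairing l v ≤ 0}
  add_mem' := by
    rintro a b ⟨l, hl, hl'⟩ ⟨m, hm, hm'⟩
    refine ⟨l + m, fun n => by simp [hl, hm], fun v hv => ?_⟩
    have : Γ.pairing (l + m) v = Γ.pairing l v + Γ.pairing m v := by
      simp [pairing, mulVec_add]
    rw [this]
    exact add_nonpos (hl' v hv) (hm' v hv)
  zero_mem' := ⟨0, fun _ => rfl, fun v _ => by simp [pairing]⟩

/-- The exponent of `t^{E_v^*}` restricted to the variables of the nodes. -/
def nodeExp (v : V) : Γ.Node → ℚ := fun n => Γ.dual v n.1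

variable {Γ}

theorem nodeExp_mem_innerCone (v : V) : Γ.nodeExp v ∈ Γ.innerCone := by
  refine ⟨Γ.dual v, fun _ => rfl, fun w _ => ?_⟩
  rw [pairing_dual]
  split_ifs <;> norm_num

/-- On the nodes `-E_e^*` agrees with `-α⁻¹ E_n^*`, whose only non-zero intersection number is at
the end node `n`, where no sign is required. -/
theorem neg_nodeExp_mem_innerCone {e : V} {n : Γ.Node} (he : Γ.valency e = 1)
    (hen : Γ.Linked e n.1) (hn : Γ.orbValency n ≤ 1) : -Γ.nodeExp e ∈ Γ.innerCone := by
  obtain ⟨α, hα, hmem⟩ := exists_sub_smul_dual_mem he hen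
  have hα' : (α : ℚ) ≠ 0 := by exact_mod_cast hα.ne'
  refine ⟨(-(α : ℚ)⁻¹) • Γ.dual n.1, fun k => ?_, fun v hv => ?_⟩
  · have := hmem.2 k
    rw [Pi.sub_apply, Pi.smul_apply, nsmul_eq_mul] at this
    simp only [Pi.neg_apply, nodeExp, Pi.smul_apply, smul_eq_mul]
    rw [sub_eq_zero.1 this]
    field_simp
  · have : Γ.pairing ((-(α : ℚ)⁻¹) • Γ.dual n.1) v = (-(α : ℚ)⁻¹) * Γ.pairing (Γ.dual n.1) v := by
      simp [pairing, mulVec_smul, mulVec_neg, neg_smul]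
    rw [this, pairing_dual, if_neg, mul_zero]
    rintro rfl
    exact hv ⟨n.2, hn⟩

theorem exists_orbGraph_walk_of_neg {β : Γ.Node → ℚ} (hβ : β ∈ Γ.innerCone) {n : Γ.Node}
    (hn : β n < 0) :
    ∃ m, Γ.orbValency m ≤ 1 ∧ ∃ q : Γ.orbGraph.Walk n m, ∀ k ∈ q.support, β k < 0 := by
  obtain ⟨l, hl, hp⟩ := hβ
  -- `K` is the connected component of `n` in `{l < 0}`. The vertex of positive intersection in it
  -- has to be an end node.
  obtain ⟨v, ⟨p, hpv⟩, hv⟩ := Γ.exists_pairing_pos (l := l)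
    (K := {v | ∃ p : Γ.graph.Walk n.1 v, ∀ x ∈ p.support, l x < 0})
    ⟨n.1, .nil, by simpa [← hl] using hn⟩ (fun v ⟨p, hp⟩ => hp v p.end_mem_support) (by
      rintro v ⟨p, hp⟩ w hw hadj
      by_contra! h
      refine hw ⟨p.concat hadj, fun x hx => ?_⟩
      rw [Walk.support_concat, List.mem_append, List.mem_singleton] at hx
      rcases hx with hx | rfl
      exacts [hp x hx, h])
  by_contra! hcon
  obtain ⟨hv3, hv1⟩ : Γ.IsEndNode v := by
    by_contra h
    exact absurd (hp v h) (not_le.2 hv)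
  obtain ⟨q, hq⟩ := exists_orbGraph_walk (m := ⟨v, hv3⟩) _ p.bypass p.bypass_isPath le_rfl
  obtain ⟨k, hk, hk0⟩ := hcon ⟨v, hv3⟩ hv1 q
  rw [hl] at hk0
  exact absurd (hpv _ (p.support_bypass_subset_support (hq k hk))) (not_lt.2 hk0)

/-- If the orbifold graph is a bamboo, the non-negative coordinates of an exponent form a
connected set of nodes. -/
theorem preconnected_induce_nonneg (hnode : Nonempty Γ.Node) (hb : Γ.OrbIsBamboo)
    {β : Γ.Node → ℚ} (hβ : β ∈ Γ.innerCone) :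
    (Γ.orbGraph.induce {n | 0 ≤ β n}).Preconnected := by
  classical
  rintro ⟨u, hu⟩ ⟨w, hw⟩
  obtain ⟨p, hp⟩ := ((orbGraph_isTree hnode).connected u w).exists_isPath
  have hdeg : ∀ n, Γ.orbGraph.degree n = Γ.orbValency n := fun n => by
    unfold orbValency
    congr!
  have := hp.support_subset_of_degree_le_two (A := {n | 0 ≤ β n})
    (fun v => by have := hb v; rw [hdeg]; omega) (fun v hv => by
      obtain ⟨m, hm, q, hq⟩ := exists_orbGraph_walk_of_neg hβ (not_le.1 hv)
      exact ⟨m, by rwa [hdeg], q, fun k hk => not_le.2 (hq k hk)⟩) hu hw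
  exact ⟨p.induce _ this⟩

end PlumbingTree

/-! ### Counting in trees -/

namespace SimpleGraph

variable {N : Type*} [Fintype N] [DecidableEq N] {T : SimpleGraph N} [DecidableRel T.Adj]

/-- The ordered pairs of adjacent vertices of `A`. -/
def innerPairs (T : SimpleGraph N) [DecidableRel T.Adj] (A : Finset N) : Finset (N × N) :=
  Finset.univ.filter fun x => T.Adj x.1 x.2 ∧ x.1 ∈ A ∧ x.2 ∈ A

theorem IsTree.card_innerPairs_add_two (hT : T.IsTree) {A : Finset N} (hA : A.Nonempty)
    (hc : (T.induce {n | n ∈ A}).Preconnected) : (T.innerPairs A).card + 2 = 2 * A.card := by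
  classical
  have : Nonempty {n | n ∈ A} := ⟨⟨_, hA.choose_spec⟩⟩
  have htree : (T.induce {n | n ∈ A}).IsTree := ⟨⟨hc⟩, hT.isAcyclic.induce _⟩
  have h1 := htree.card_edgeFinset
  have h2 := (T.induce {n | n ∈ A}).two_mul_card_edgeFinset
  have h3 : Fintype.card {n | n ∈ A} = A.card := by
    simp
  have h4 : (T.innerPairs A).card =
      (Finset.univ.filter fun (x, y) => (T.induce {n | n ∈ A}).Adj x y).card := by
    symm
    apply Finset.card_bij (fun x _ => (x.1.1, x.2.1))
    · rintro ⟨x, y⟩ h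
      simp only [Finset.mem_filter, Finset.mem_univ, true_and, comap_adj] at h
      simp only [innerPairs, Finset.mem_filter, Finset.mem_univ, true_and]
      exact ⟨h, x.2, y.2⟩
    · rintro ⟨x, y⟩ - ⟨x', y'⟩ - h
      exact Prod.ext (Subtype.ext (Prod.mk.inj h).1) (Subtype.ext (Prod.mk.inj h).2)
    · rintro ⟨x, y⟩ h
      simp only [innerPairs, Finset.mem_filter, Finset.mem_univ, true_and] at h
      exact ⟨(⟨x, h.2.1⟩, ⟨y, h.2.2⟩), by simpa using h.1, rfl⟩
  rw [h3] at h1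
  rw [h4, ← h2]
  omega

theorem card_filter_adj_mem (A : Finset N) :
    (Finset.univ.filter fun x : N × N => T.Adj x.1 x.2 ∧ x.1 ∈ A).card = ∑ n ∈ A, T.degree n := by
  rw [Finset.card_eq_sum_card_fiberwise (f := Prod.fst) (t := A) (by
    intro x hx
    exact (Finset.mem_filter.1 hx).2.2)]
  refine Finset.sum_congr rfl fun n hn => ?_
  rw [← card_neighborFinset_eq_degree]
  symm
  apply Finset.card_bij (fun m _ => (n, m))
  · intro m hm
    rw [mem_neighborFinset] at hm
    simp [hm, hn]
  · intro m _ m' _ h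
    exact (Prod.mk.inj h).2
  · rintro ⟨x, y⟩ h
    simp only [Finset.mem_filter, Finset.mem_univ, true_and] at h
    obtain ⟨⟨h, -⟩, rfl⟩ := h
    exact ⟨y, by rwa [mem_neighborFinset], rfl⟩

/-- Inclusion-exclusion for ordered adjacent pairs with first entry, respectively second entry, in
`A`. -/
theorem two_mul_card_edges_touching (A : Finset N) :
    2 * (T.edgeFinset.filter fun e => ∃ n ∈ e, n ∈ A).card + (T.innerPairs A).card =
      2 * ∑ n ∈ A, T.degree n := by
  classical
  let T' : SimpleGraph N :=
    { Adj := fun n m => T.Adj n m ∧ (n ∈ A ∨ m ∈ A)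
      symm := ⟨fun n m h => ⟨h.1.symm, h.2.symm⟩⟩
      loopless := ⟨fun n h => h.1.ne rfl⟩ }
  have h1 : (T.edgeFinset.filter fun e => ∃ n ∈ e, n ∈ A) = T'.edgeFinset := by
    ext e
    induction e with
    | h n m => simp [T']
  have h2 := T'.two_mul_card_edgeFinset
  rw [h1, h2]
  have h3 : (Finset.univ.filter fun x : N × N => T.Adj x.1 x.2 ∧ x.2 ∈ A).card =
      ∑ n ∈ A, T.degree n := by
    rw [← card_filter_adj_mem]
    apply Finset.card_bij (fun x _ => (x.2, x.1))
    · intro x hx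
      simpa [T.adj_comm] using hx
    · intro x _ y _ h
      exact Prod.ext (Prod.mk.inj h).2 (Prod.mk.inj h).1
    · rintro ⟨x, y⟩ h
      exact ⟨(y, x), by simpa [T.adj_comm] using h, rfl⟩
  rw [two_mul]
  conv_rhs => enter [2]; rw [← h3]
  rw [← card_filter_adj_mem]
  refine Eq.trans ?_ (Finset.card_union_add_card_inter _ _)
  congr 2
  · ext x
    simp only [Finset.mem_filter, Finset.mem_univ, true_and, Finset.mem_union, T']
    tauto
  · ext x
    simp only [innerPairs, Finset.mem_filter, Finset.mem_univ, true_and, Finset.mem_inter]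
    tauto

theorem IsTree.exists_parent (hT : T.IsTree) {n n₀ : N} (hn : n ≠ n₀) :
    ∃! m, T.Adj n m ∧ T.dist n n₀ = T.dist m n₀ + 1 := by
  have huniq : ∀ m, T.Adj n m → T.dist n n₀ = T.dist m n₀ + 1 →
      ∃ p : T.Walk n n₀, p.IsPath ∧ p.snd = m := by
    intro m hm hd
    obtain ⟨p, hp, hl⟩ := hT.connected.exists_path_of_dist m n₀
    exact ⟨.cons hm p, Walk.isPath_of_length_eq_dist _ (by rw [Walk.length_cons, hl, hd]), by simp⟩
  obtain ⟨p, hp, hl⟩ := hT.connected.exists_path_of_dist n n₀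
  cases p with
  | nil => exact absurd rfl hn
  | @cons _ m _ h q =>
    rw [Walk.length_cons] at hl
    have hd : T.dist n n₀ = T.dist m n₀ + 1 := by
      have h1 := dist_le q
      rcases hT.dist_eq_dist_add_one_of_adj n₀ h with h2 | h2 <;>
        rw [dist_comm (u := n₀), dist_comm (u := n₀)] at h2 <;> omega
    refine ⟨m, ⟨h, hd⟩, fun m' hm' => ?_⟩
    obtain ⟨p, hp, rfl⟩ := huniq m' hm'.1 hm'.2
    obtain ⟨p', hp', hs⟩ := huniq m h hd
    rw [← hs, (hT.existsUnique_path n n₀).unique hp hp']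

/-- Every vertex of `A` other than `n₀` has exactly one edge towards `n₀`. Of these edges `|A| - 1`
stay inside the subtree `A`, so exactly one leaves it if `n₀ ∉ A`, and none if `n₀ ∈ A`. -/
theorem IsTree.card_roots_eq_one (hT : T.IsTree) {A : Finset N} (hA : A.Nonempty)
    (hc : (T.induce {n | n ∈ A}).Preconnected) (n₀ : N) :
    (if n₀ ∈ A then 1 else 0) + (Finset.univ.filter fun x : N × N =>
      (T.Adj x.1 x.2 ∧ T.dist x.1 n₀ = T.dist x.2 n₀ + 1) ∧ x.1 ∈ A ∧ x.2 ∉ A).card = 1 := by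
  set down : N × N → Prop := fun x => T.Adj x.1 x.2 ∧ T.dist x.1 n₀ = T.dist x.2 n₀ + 1
    with hdown
  have h1 : (Finset.univ.filter fun x : N × N => down x ∧ x.1 ∈ A).card = (A.erase n₀).card := by
    apply Finset.card_bij (fun x _ => x.1)
    · intro x hx
      simp only [Finset.mem_filter, Finset.mem_univ, true_and] at hx
      refine Finset.mem_erase.2 ⟨fun h => ?_, hx.2⟩
      have := hx.1.2
      rw [h, dist_self] at this
      omega
    · rintro ⟨x, y⟩ hx ⟨x', y'⟩ hx' (rfl : x = x')
      simp only [Finset.mem_filter, Finset.mem_univ, true_and] at hx hx'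
      have hne : x ≠ n₀ := by
        rintro rfl
        have := hx.1.2
        rw [dist_self] at this
        omega
      exact Prod.ext rfl ((hT.exists_parent hne).unique hx.1 hx'.1)
    · intro x hx
      rw [Finset.mem_erase] at hx
      obtain ⟨y, hy, -⟩ := hT.exists_parent hx.1
      exact ⟨(x, y), by simp only [Finset.mem_filter, Finset.mem_univ, true_and]; exact ⟨hy, hx.2⟩,
        rfl⟩
  have h2 : (Finset.univ.filter fun x : N × N => down x ∧ x.1 ∈ A).card =
      (Finset.univ.filter fun x : N × N => down x ∧ x.1 ∈ A ∧ x.2 ∈ A).card +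
      (Finset.univ.filter fun x : N × N => down x ∧ x.1 ∈ A ∧ x.2 ∉ A).card := by
    rw [← Finset.card_union_of_disjoint]
    · congr 1
      ext x
      simp only [Finset.mem_filter, Finset.mem_univ, true_and, Finset.mem_union]
      tauto
    · rw [Finset.disjoint_left]
      intro x hx hx'
      exact (Finset.mem_filter.1 hx').2.2.2 (Finset.mem_filter.1 hx).2.2.2
  have h3 : (T.innerPairs A).card =
      2 * (Finset.univ.filter fun x : N × N => down x ∧ x.1 ∈ A ∧ x.2 ∈ A).card := by
    have : (Finset.univ.filter fun x : N × N => down x ∧ x.1 ∈ A ∧ x.2 ∈ A).card =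
        (Finset.univ.filter fun x : N × N => down x.swap ∧ x.1 ∈ A ∧ x.2 ∈ A).card := by
      apply Finset.card_bij (fun x _ => x.swap)
      · intro x hx
        simp only [Finset.mem_filter, Finset.mem_univ, true_and, Prod.swap_swap, Prod.fst_swap,
          Prod.snd_swap] at hx ⊢
        tauto
      · intro x _ y _ h
        exact Prod.swap_injective h
      · intro x hx
        simp only [Finset.mem_filter, Finset.mem_univ, true_and] at hx
        refine ⟨x.swap, ?_, Prod.swap_swap x⟩
        simp only [Finset.mem_filter, Finset.mem_univ, true_and, Prod.fst_swap, Prod.snd_swap]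
        tauto
    rw [two_mul]
    conv_rhs => enter [2]; rw [this]
    rw [← Finset.card_union_of_disjoint]
    · congr 1
      ext ⟨x, y⟩
      simp only [innerPairs, Finset.mem_filter, Finset.mem_univ, true_and, Finset.mem_union, hdown,
        Prod.fst_swap, Prod.snd_swap]
      constructor
      · rintro ⟨h, hx, hy⟩
        rcases hT.dist_eq_dist_add_one_of_adj n₀ h with h2 | h2 <;>
          rw [dist_comm (u := n₀), dist_comm (u := n₀)] at h2
        · exact Or.inl ⟨⟨h, h2⟩, hx, hy⟩
        · exact Or.inr ⟨⟨h.symm, h2⟩, hx, hy⟩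
      · rintro (⟨h, hxy⟩ | ⟨h, hxy⟩)
        exacts [⟨h.1, hxy⟩, ⟨h.1.symm, hxy⟩]
    · rw [Finset.disjoint_left]
      intro x hx hx'
      have h1 := (Finset.mem_filter.1 hx).2.1.2
      have h2 := (Finset.mem_filter.1 hx').2.1.2
      simp only [Prod.fst_swap, Prod.snd_swap] at h2
      omega
  have h4 := hT.card_innerPairs_add_two hA hc
  by_cases hn₀ : n₀ ∈ A
  · have := Finset.card_erase_add_one hn₀
    rw [if_pos hn₀]
    simp only [hdown] at h1 h2 h3
    omega
  · rw [Finset.erase_eq_of_notMem hn₀] at h1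
    rw [if_neg hn₀]
    simp only [hdown] at h1 h2 h3
    omega

end SimpleGraph

/-! ### Multiplicities -/

namespace PlumbingTree

open SimpleGraph

variable {V : Type*} [Fintype V] [DecidableEq V] {Γ : PlumbingTree V}

theorem multiplicity_eq_one (hnode : Nonempty Γ.Node) {β : Γ.Node → ℚ} (hβ : ∃ n, 0 ≤ β n)
    (hc : (Γ.orbGraph.induce {n | 0 ≤ β n}).Preconnected) (n₀ : Γ.Node) :
    Γ.multiplicity n₀ β = 1 := by
  classical
  obtain ⟨n, hn⟩ := hβ
  have hset : {n | n ∈ Finset.univ.filter fun n => 0 ≤ β n} = {n | 0 ≤ β n} := by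
    ext; simp
  have h := (orbGraph_isTree hnode).card_roots_eq_one (A := Finset.univ.filter fun n => 0 ≤ β n)
    ⟨n, by simpa using hn⟩ (by rw [hset]; exact hc) n₀
  rw [← h]
  unfold multiplicity
  congr 1
  · simp
  · rw [Finset.card_filter, ← Finset.univ_product_univ, Finset.sum_product]
    refine Finset.sum_congr rfl fun n _ => Finset.sum_congr rfl fun m _ => ?_
    simp only [Finset.mem_filter, Finset.mem_univ, true_and, not_le]
    by_cases h1 : Γ.OrbGT n₀ n m
    · by_cases h2 : 0 ≤ β n ∧ β m < 0
      · rw [if_pos h1, if_pos h2, if_pos ⟨h1, h2⟩]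
      · rw [if_pos h1, if_neg h2, if_neg fun h => h2 h.2]
    · rw [if_neg h1, if_neg fun h => h1 h.1]

-- The edges touching `A = {n | 0 ≤ β n}` number `∑_{n ∈ A} δ_{n,𝒩}` minus the `|A| - 1` edges
-- inside `A`, which are counted twice in that sum.
open Classical in
theorem card_edges_sub_sum (hnode : Nonempty Γ.Node) {β : Γ.Node → ℚ} (hβ : ∃ n, 0 ≤ β n)
    (hc : (Γ.orbGraph.induce {n | 0 ≤ β n}).Preconnected) :
    (∑ e ∈ Γ.orbGraph.edgeFinset, if ∃ n ∈ e, 0 ≤ β n then 1 else 0 : ℤ) -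
      (∑ n : Γ.Node, if 0 ≤ β n then (Γ.orbValency n : ℤ) - 1 else 0) = 1 := by
  obtain ⟨n, hn⟩ := hβ
  set A : Finset Γ.Node := Finset.univ.filter fun n => 0 ≤ β n with hA
  have hset : {n | n ∈ A} = {n | 0 ≤ β n} := by
    ext; simp [hA]
  have h1 := (orbGraph_isTree hnode).card_innerPairs_add_two (A := A)
    ⟨n, by simpa [hA] using hn⟩
    (by rw [hset]; exact hc)
  have h2 := two_mul_card_edges_touching (T := Γ.orbGraph) A
  rw [← Finset.sum_filter, ← Finset.sum_filter, Finset.sum_sub_distrib, Finset.sum_const,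
    Finset.sum_const, nsmul_eq_mul, nsmul_eq_mul, mul_one, mul_one, ← hA]
  have h3 : (Γ.orbGraph.edgeFinset.filter fun e => ∃ n ∈ e, n ∈ A) =
      Γ.orbGraph.edgeFinset.filter fun e => ∃ n ∈ e, 0 ≤ β n := by
    simp [hA]
  have h4 : ∑ n ∈ A, Γ.orbGraph.degree n = ∑ n ∈ A, Γ.orbValency n :=
    Finset.sum_congr rfl fun n _ => by unfold orbValency; congr!
  rw [h3, h4] at h2
  have h5 : ((∑ n ∈ A, Γ.orbValency n : ℕ) : ℤ) = ∑ n ∈ A, (Γ.orbValency n : ℤ) := by simp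
  rw [← h5]
  omega

end PlumbingTree

/-! ### Parts of an element of a monoid algebra -/

section ClassPart

variable {H E : Type*} [AddCommGroup H] [AddCommGroup E]

/-- The sum of the terms whose exponent has first component `h`. -/
def classPart (h : H) : AddMonoidAlgebra ℤ (H × E) →+ AddMonoidAlgebra ℤ E where
  toFun A := AddMonoidAlgebra.ofCoeff
    (A.coeff.comapDomain (fun β => (h, β)) (Prod.mk_right_injective h).injOn)
  map_zero' := by
    apply AddMonoidAlgebra.ext
    ext β
    simp
  map_add' A B := by
    apply AddMonoidAlgebra.ext
    ext β
    simp

theorem coeff_classPart (h : H) (A : AddMonoidAlgebra ℤ (H × E)) (β : E) :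
    (classPart h A).coeff β = A.coeff (h, β) := rfl

open Classical in
theorem classPart_single (h : H) (x : H × E) (r : ℤ) :
    classPart h (AddMonoidAlgebra.single x r) =
      if x.1 = h then AddMonoidAlgebra.single x.2 r else 0 := by
  apply AddMonoidAlgebra.ext
  ext β
  rw [coeff_classPart]
  obtain ⟨a, b⟩ := x
  by_cases hx : a = h
  · by_cases hb : b = β <;> simp [hx, hb]
  · simp [hx]

/-- The inclusion of the elements whose exponents have vanishing first component. -/
def classZero (H E : Type*) [AddCommGroup H] [AddCommGroup E] :
    AddMonoidAlgebra ℤ E →+* AddMonoidAlgebra ℤ (H × E) :=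
  AddMonoidAlgebra.mapDomainRingHom ℤ (AddMonoidHom.inr H E)

theorem classZero_single (β : E) (r : ℤ) :
    classZero H E (AddMonoidAlgebra.single β r) = AddMonoidAlgebra.single (0, β) r := by
  simp [classZero]

/-- Multiplication by an element of class zero does not change classes, so denominators of class
zero pass through the extraction of the `h`-part. -/
theorem classPart_mul_classZero (h : H) (A : AddMonoidAlgebra ℤ (H × E))
    (B : AddMonoidAlgebra ℤ E) :
    classPart h (A * classZero H E B) = classPart h A * B := by
  induction A using AddMonoidAlgebra.induction_linear with
  | zero => simp
  | add A A' hA hA' => rw [add_mul, map_add, hA, hA', map_add, add_mul]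
  | single x r =>
    induction B using AddMonoidAlgebra.induction_linear with
    | zero => simp
    | add B B' hB hB' => rw [map_add, mul_add, map_add, hB, hB', mul_add]
    | single β s =>
      rw [classZero_single, AddMonoidAlgebra.single_mul_single, classPart_single, classPart_single]
      by_cases hx : x.1 = h
      · simp [hx, AddMonoidAlgebra.single_mul_single]
      · simp [hx]

theorem classPart_mem_supportedIn {h : H} {Q : AddSubmonoid E} {A : AddMonoidAlgebra ℤ (H × E)}
    (hA : A ∈ supportedIn ℤ ((⊤ : AddSubmonoid H).prod Q)) :
    classPart h A ∈ supportedIn ℤ Q := by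
  intro β hβ
  have : (h, β) ∈ A.coeff.support := by
    rw [Finsupp.mem_support_iff] at hβ ⊢
    exact hβ
  exact (AddSubmonoid.mem_prod.1 (hA _ this)).2

end ClassPart

/-! ### The zeta function -/

namespace PlumbingTree

open SimpleGraph

variable {V : Type*} [Fintype V] [DecidableEq V] (Γ : PlumbingTree V)

/-- The class `[E_v^*] ∈ H`. -/
def dualClass (v : V) : Γ.H :=
  QuotientAddGroup.mk (⟨Γ.dual v, AddSubgroup.subset_closure ⟨v, rfl⟩⟩ : Γ.dualLattice)

theorem classOf_eq (k : V →₀ ℕ) : Γ.classOf k = ∑ v, k v • Γ.dualClass v := by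
  exact (map_sum (QuotientAddGroup.mk' ((lattice V).addSubgroupOf Γ.dualLattice)) _ _).trans
    (Finset.sum_congr rfl fun v _ => map_nsmul _ _ _)

theorem classOf_add (k l : V →₀ ℕ) : Γ.classOf (k + l) = Γ.classOf k + Γ.classOf l := by
  simp [classOf_eq, add_smul, Finset.sum_add_distrib]

theorem dualClass_eq_of_sub_mem {u v : V} {α : ℕ} (h : Γ.dual u - α • Γ.dual v ∈ lattice V) :
    Γ.dualClass u = α • Γ.dualClass v := by
  rw [← sub_eq_zero]
  have : Γ.dualClass u - α • Γ.dualClass v = QuotientAddGroup.mk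
      ((⟨Γ.dual u, AddSubgroup.subset_closure ⟨u, rfl⟩⟩ : Γ.dualLattice) -
        α • ⟨Γ.dual v, AddSubgroup.subset_closure ⟨v, rfl⟩⟩) := rfl
  rw [this, QuotientAddGroup.eq_zero_iff, AddSubgroup.mem_addSubgroupOf]
  exact h

theorem mem_lattice_iff {l : V → ℚ} : l ∈ lattice V ↔ ∀ v, ∃ z : ℤ, (z : ℚ) = l v := by
  simp [lattice, AddSubgroup.mem_pi, AddSubgroup.mem_zmultiples_iff]

/-- A common denominator of all coordinates of the `E_v^*` works. It allows denominators `1 - t^{d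
E_v^*}` of class zero. -/
theorem exists_smul_dualClass_eq_zero : ∃ d : ℕ, 0 < d ∧ ∀ v, d • Γ.dualClass v = 0 := by
  obtain ⟨b, hb⟩ := IsLocalization.exist_integer_multiples_of_finite (nonZeroDivisors ℤ)
    (fun x : V × V => Γ.dual x.1 x.2)
  have hb0 : (b : ℤ) ≠ 0 := nonZeroDivisors.coe_ne_zero b
  refine ⟨(b : ℤ).natAbs, Int.natAbs_pos.2 hb0, fun v => ?_⟩
  have key : (b : ℤ) • Γ.dualClass v = 0 := by
    have : (b : ℤ) • Γ.dualClass v = QuotientAddGroup.mk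
      ((b : ℤ) • (⟨Γ.dual v, AddSubgroup.subset_closure ⟨v, rfl⟩⟩ : Γ.dualLattice)) := rfl
    rw [this, QuotientAddGroup.eq_zero_iff, AddSubgroup.mem_addSubgroupOf]
    refine mem_lattice_iff.2 fun w => ?_
    obtain ⟨z, hz⟩ := hb (v, w)
    exact ⟨z, by simpa using hz⟩
  rcases Int.natAbs_eq (b : ℤ) with h | h
  · rw [← natCast_zsmul, ← h, key]
  · have h2 : (((b : ℤ).natAbs : ℕ) : ℤ) = -(b : ℤ) := by omega
    rw [← natCast_zsmul, h2, neg_smul, key, neg_zero]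

/-- The exponent of `t^{E_v^*}`, together with its class in `H`. -/
def gradedExp (v : V) : Γ.H × (Γ.Node → ℚ) := (Γ.dualClass v, Γ.nodeExp v)

/-- The monomial `t^{E_v^*}` in the variables of the nodes, graded by `H`. -/
def gradedMonomial (v : V) : AddMonoidAlgebra ℤ (Γ.H × (Γ.Node → ℚ)) :=
  AddMonoidAlgebra.single (Γ.gradedExp v) 1

/-- The reduction of the variables to those of the nodes, graded by `H`. -/
def gradedReduce : MvPolynomial V ℤ →ₐ[ℤ] AddMonoidAlgebra ℤ (Γ.H × (Γ.Node → ℚ)) :=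
  MvPolynomial.aeval Γ.gradedMonomial

theorem aeval_single_monomial {G : Type*} [AddCommMonoid G] (x : V → G) (k : V →₀ ℕ) (c : ℤ) :
    MvPolynomial.aeval (R := ℤ) (fun v => (AddMonoidAlgebra.single (x v) 1 : AddMonoidAlgebra ℤ G))
      (MvPolynomial.monomial k c) = AddMonoidAlgebra.single (∑ v, k v • x v) c := by
  classical
  rw [MvPolynomial.aeval_monomial, Finsupp.prod_fintype _ _ (fun _ => pow_zero _)]
  simp only [AddMonoidAlgebra.single_pow, one_pow]
  have : ∀ s : Finset V, ∏ v ∈ s, (AddMonoidAlgebra.single (k v • x v) 1 : AddMonoidAlgebra ℤ G) =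
      AddMonoidAlgebra.single (∑ v ∈ s, k v • x v) 1 := by
    intro s
    induction s using Finset.induction_on with
    | empty => simp [AddMonoidAlgebra.one_def]
    | insert v s hv ih =>
      rw [Finset.prod_insert hv, Finset.sum_insert hv, ih, AddMonoidAlgebra.single_mul_single,
        one_mul]
  rw [this, ← Algebra.smul_def, AddMonoidAlgebra.smul_single, smul_eq_mul, mul_one]

theorem reduce_monomial (k : V →₀ ℕ) (c : ℤ) :
    Γ.reduce (MvPolynomial.monomial k c) = AddMonoidAlgebra.single (∑ v, k v • Γ.nodeExp v) c :=
  aeval_single_monomial Γ.nodeExp k c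

theorem gradedReduce_monomial (k : V →₀ ℕ) (c : ℤ) :
    Γ.gradedReduce (MvPolynomial.monomial k c) =
      AddMonoidAlgebra.single (Γ.classOf k, ∑ v, k v • Γ.nodeExp v) c := by
  have h := aeval_single_monomial Γ.gradedExp k c
  have h2 : ∑ v, k v • Γ.gradedExp v = (Γ.classOf k, ∑ v, k v • Γ.nodeExp v) := by
    rw [classOf_eq]
    apply Prod.ext
    · rw [Prod.fst_sum]; rfl
    · rw [Prod.snd_sum]; rfl
  rw [h2] at h
  exact h

open Classical in
/-- The part of class `h` of a polynomial. -/
def polyClassPart (h : Γ.H) (g : MvPolynomial V ℤ) : MvPolynomial V ℤ :=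
  ∑ k ∈ g.support.filter (fun k => Γ.classOf k = h), MvPolynomial.monomial k (g.coeff k)

open Classical in
theorem coeff_polyClassPart (h : Γ.H) (g : MvPolynomial V ℤ) (k : V →₀ ℕ) :
    (Γ.polyClassPart h g).coeff k = if Γ.classOf k = h then g.coeff k else 0 := by
  rw [polyClassPart, MvPolynomial.coeff_sum]
  simp only [MvPolynomial.coeff_monomial, Finset.sum_ite_eq', Finset.mem_filter,
    MvPolynomial.mem_support_iff]
  by_cases h1 : Γ.classOf k = h <;> by_cases h2 : g.coeff k = 0 <;> simp [h1, h2]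

/-- Setting `t_v = 1` off the nodes loses the class of an exponent. Carrying the class as a separate
grading allows factorisation after the reduction and extraction of the `h`-part last. -/
theorem reduce_polyClassPart (h : Γ.H) (g : MvPolynomial V ℤ) :
    Γ.reduce (Γ.polyClassPart h g) = classPart h (Γ.gradedReduce g) := by
  classical
  conv_rhs => rw [g.as_sum]
  rw [polyClassPart, map_sum, map_sum, map_sum, Finset.sum_filter]
  refine Finset.sum_congr rfl fun k _ => ?_
  rw [gradedReduce_monomial, classPart_single, reduce_monomial]
  congr!

variable {Γ}

theorem mul_poincarePart {q g : MvPolynomial V ℤ} (hq : ∀ k, q.coeff k ≠ 0 → Γ.classOf k = 0)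
    (hg : (q : MvPowerSeries V ℤ) * Γ.poincare = g) (h : Γ.H) :
    (q : MvPowerSeries V ℤ) * Γ.poincarePart h = (Γ.polyClassPart h g : MvPolynomial V ℤ) := by
  classical
  ext k
  have hk := congrArg (MvPowerSeries.coeff k) hg
  rw [MvPowerSeries.coeff_mul, MvPolynomial.coeff_coe] at hk
  rw [MvPolynomial.coeff_coe, coeff_polyClassPart, ← hk, MvPowerSeries.coeff_mul,
    Finset.sum_congr rfl (g := fun x => if Γ.classOf k = h then
      MvPowerSeries.coeff x.1 (q : MvPowerSeries V ℤ) * MvPowerSeries.coeff x.2 Γ.poincare else 0)]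
  · split_ifs
    · rfl
    · exact Finset.sum_const_zero
  · intro x hx
    by_cases h0 : q.coeff x.1 = 0
    · rw [MvPolynomial.coeff_coe, h0]
      simp
    · have hk : Γ.classOf k = Γ.classOf x.2 := by
        rw [← Finset.HasAntidiagonal.mem_antidiagonal.1 hx, classOf_add, hq _ h0, zero_add]
      have h2 : MvPowerSeries.coeff x.2 (Γ.poincarePart h) =
          if Γ.classOf x.2 = h then MvPowerSeries.coeff x.2 Γ.poincare else 0 := rfl
      rw [h2, hk, mul_ite, mul_zero]

theorem IsReducedZeta.unique (hnode : Nonempty Γ.Node) {h : Γ.H} {F F' : RatFun Γ.Node}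
    (hF : Γ.IsReducedZeta h F) (hF' : Γ.IsReducedZeta h F') : F = F' := by
  -- All coordinates of the `E_v^*` are positive, so only the constant term of `q` reduces to
  -- exponent zero and it cannot cancel.
  have key : ∀ q : MvPolynomial V ℤ, q.constantCoeff ≠ 0 → Γ.reduce q ≠ 0 := by
    intro q hq h0
    apply hq
    obtain ⟨n⟩ := hnode
    have h1 : (Γ.reduce q).coeff 0 = q.constantCoeff := by
      conv_lhs => rw [q.as_sum]
      rw [map_sum, AddMonoidAlgebra.coeff_sum, Finsupp.finsetSum_apply,
        Finset.sum_eq_single 0]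
      · rw [reduce_monomial]
        simp [MvPolynomial.constantCoeff_eq]
      · intro k _ hk
        rw [reduce_monomial, AddMonoidAlgebra.coeff_single, Finsupp.single_apply, if_neg]
        intro hsum
        obtain ⟨v, hv⟩ := Finsupp.ne_iff.1 hk
        have hpos : 0 < ∑ v, (k v : ℚ) * Γ.dual v n.1 := by
          refine Finset.sum_pos' (fun v _ => mul_nonneg (Nat.cast_nonneg _) (Γ.dual_nonneg v _))
            ⟨v, Finset.mem_univ v, mul_pos ?_ (Γ.dual_pos v _)⟩
          exact_mod_cast Nat.pos_of_ne_zero hv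
        have := congrFun hsum n
        rw [Finset.sum_apply] at this
        simp only [Pi.smul_apply, nodeExp, nsmul_eq_mul, Pi.zero_apply] at this
        exact hpos.ne' this
      · intro h0
        rw [MvPolynomial.notMem_support_iff] at h0
        rw [h0]
        simp
    rw [← h1, h0]
    simp
  obtain ⟨p, q, hq, hp, rfl⟩ := hF
  obtain ⟨p', q', hq', hp', rfl⟩ := hF'
  rw [div_eq_div_iff (algebraMap_ratFun_ne_zero (key q hq))
    (algebraMap_ratFun_ne_zero (key q' hq')), ← map_mul, ← map_mul, ← map_mul, ← map_mul]
  congr 2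
  rw [← MvPolynomial.coe_inj, MvPolynomial.coe_mul, MvPolynomial.coe_mul, ← hp, ← hp']
  ring

end PlumbingTree

/-! ### Numerator and denominator of the reduced zeta function, and their cancellation -/

namespace PlumbingTree

open SimpleGraph

variable {V : Type*} [Fintype V] [DecidableEq V] (Γ : PlumbingTree V)

/-- The vertices of valency one. -/
def leaves : Finset V := Finset.univ.filter fun v => Γ.valency v = 1

theorem mem_leaves {v : V} : v ∈ Γ.leaves ↔ Γ.valency v = 1 := by
  simp [leaves]

/-- A numerator of the zeta function for the denominator `zetaDen`. -/
def zetaNum (d : ℕ) : MvPolynomial V ℤ :=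
  ∏ v, if Γ.valency v = 1 then ∑ k ∈ Finset.range d, MvPolynomial.X v ^ k
    else (1 - MvPolynomial.X v) ^ (Γ.valency v - 2)

/-- The denominator `∏ (1 - X_v^d)`, the product being over the leaves. -/
def zetaDen (d : ℕ) : MvPolynomial V ℤ := ∏ v ∈ Γ.leaves, (1 - MvPolynomial.X v ^ d)

variable {Γ}

theorem one_le_valency (hnode : Nonempty Γ.Node) (v : V) : 1 ≤ Γ.valency v := by
  classical
  obtain ⟨n, hn⟩ := hnode
  obtain ⟨p⟩ := Γ.isTree.connected v n
  cases p with
  | nil => omega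
  | cons h p =>
    unfold valency
    rw [Nat.one_le_iff_ne_zero, ← Nat.pos_iff_ne_zero, degree_pos_iff_exists_adj]
    exact ⟨_, h⟩

theorem zetaDen_mul_poincare (hnode : Nonempty Γ.Node) (d : ℕ) :
    (Γ.zetaDen d : MvPowerSeries V ℤ) * Γ.poincare = (Γ.zetaNum d : MvPowerSeries V ℤ) := by
  rw [zetaDen, zetaNum, leaves, Finset.prod_filter, poincare,
    ← MvPolynomial.coeToMvPowerSeries.ringHom_apply,
    ← MvPolynomial.coeToMvPowerSeries.ringHom_apply, map_prod, map_prod, ← Finset.prod_mul_distrib]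
  refine Finset.prod_congr rfl fun v _ => ?_
  have hu : ((isUnit_one_sub_X v).unit : MvPowerSeries V ℤ) = 1 - MvPowerSeries.X v := rfl
  by_cases hv : Γ.valency v = 1
  · rw [if_pos hv, if_pos hv, hv]
    have h1 : ((1 : ℕ) : ℤ) - 2 = -1 := by norm_num
    rw [h1, zpow_neg_one, Units.mul_inv_eq_iff_eq_mul, hu, map_sum, map_sub, map_pow, map_one]
    simp only [map_pow, MvPolynomial.coeToMvPowerSeries.ringHom_apply, MvPolynomial.coe_X]
    rw [geom_sum_mul_neg]
  -- The truncated subtraction is harmless: the valency is at least one and differs from one.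
  · have h2 : (Γ.valency v : ℤ) - 2 = ((Γ.valency v - 2 : ℕ) : ℤ) := by
      have := one_le_valency hnode v
      omega
    rw [if_neg hv, if_neg hv, map_one, one_mul, h2, zpow_natCast, Units.val_pow_eq_pow_val, hu,
      map_pow, map_sub, map_one, MvPolynomial.coeToMvPowerSeries.ringHom_apply,
      MvPolynomial.coe_X]

theorem classOf_eq_zero_of_coeff_zetaDen {d : ℕ} (hd : ∀ v, d • Γ.dualClass v = 0) {k : V →₀ ℕ}
    (hk : (Γ.zetaDen d).coeff k ≠ 0) : Γ.classOf k = 0 := by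
  have : Γ.zetaDen d = MvPolynomial.expand d (∏ v ∈ Γ.leaves, (1 - MvPolynomial.X v)) := by
    simp [zetaDen, map_prod]
  rw [this, ← MvPolynomial.mem_support_iff] at hk
  obtain ⟨m, -, rfl⟩ := Finset.mem_image.1 (MvPolynomial.support_expand_subset _ hk)
  rw [classOf_eq]
  refine Finset.sum_eq_zero fun v _ => ?_
  rw [Finsupp.smul_apply, smul_eq_mul, mul_comm, mul_smul, hd, smul_zero]

theorem constantCoeff_zetaDen {d : ℕ} (hd : 0 < d) : (Γ.zetaDen d).constantCoeff = 1 := by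
  simp [zetaDen, map_prod, hd.ne']

theorem isReducedZeta_zetaDen (hnode : Nonempty Γ.Node) {d : ℕ} (hd0 : 0 < d)
    (hd : ∀ v, d • Γ.dualClass v = 0) (h : Γ.H) :
    Γ.IsReducedZeta h (algebraMap (LaurentPoly Γ.Node) (RatFun Γ.Node)
        (classPart h (Γ.gradedReduce (Γ.zetaNum d))) /
      algebraMap (LaurentPoly Γ.Node) (RatFun Γ.Node)
        (∏ v ∈ Γ.leaves, oneSub (d • Γ.nodeExp v))) := by
  refine ⟨Γ.polyClassPart h (Γ.zetaNum d), Γ.zetaDen d, ?_, ?_, ?_⟩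
  · rw [constantCoeff_zetaDen hd0]
    exact one_ne_zero
  · exact mul_poincarePart (fun k => classOf_eq_zero_of_coeff_zetaDen hd)
      (zetaDen_mul_poincare hnode d) h
  · rw [reduce_polyClassPart]
    congr 2
    rw [zetaDen, map_prod]
    refine Finset.prod_congr rfl fun v _ => ?_
    rw [map_sub, map_one, map_pow, oneSub]
    congr 1
    rw [reduce, MvPolynomial.aeval_X, AddMonoidAlgebra.single_pow, one_pow]
    rfl

theorem gradedReduce_zetaNum (d : ℕ) : Γ.gradedReduce (Γ.zetaNum d) =
    (∏ v ∈ Γ.leaves, ∑ k ∈ Finset.range d, Γ.gradedMonomial v ^ k) *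
      ∏ v ∈ Γ.leavesᶜ, (1 - Γ.gradedMonomial v) ^ (Γ.valency v - 2) := by
  have hX : ∀ v, Γ.gradedReduce (MvPolynomial.X v) = Γ.gradedMonomial v := fun v =>
    MvPolynomial.aeval_X _ v
  rw [zetaNum, map_prod, ← Finset.prod_mul_prod_compl Γ.leaves]
  congr 1
  · refine Finset.prod_congr rfl fun v hv => ?_
    rw [if_pos (Γ.mem_leaves.1 hv), map_sum]
    simp only [map_pow, hX]
  · refine Finset.prod_congr rfl fun v hv => ?_
    rw [Finset.mem_compl] at hv
    rw [if_neg (fun h => hv (Γ.mem_leaves.2 h)), map_pow, map_sub, map_one, hX]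

theorem one_sub_gradedMonomial_pow {d : ℕ} {v : V} (hd : d • Γ.dualClass v = 0) :
    1 - Γ.gradedMonomial v ^ d = classZero Γ.H (Γ.Node → ℚ) (oneSub (d • Γ.nodeExp v)) := by
  rw [oneSub, map_sub, map_one, classZero_single, gradedMonomial, AddMonoidAlgebra.single_pow,
    one_pow]
  congr 2
  exact Prod.ext hd rfl

theorem gradedMonomial_mem_supportedIn (v : V) :
    Γ.gradedMonomial v ∈ supportedIn ℤ ((⊤ : AddSubmonoid Γ.H).prod Γ.innerCone) :=
  single_mem_supportedIn (AddSubmonoid.mem_prod.2 ⟨AddSubmonoid.mem_top _,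
    nodeExp_mem_innerCone v⟩) 1

theorem exists_gradedMonomial_eq_pow {e : V} {n : Γ.Node} (he : Γ.valency e = 1)
    (hen : Γ.Linked e n.1) : ∃ α : ℕ, Γ.gradedMonomial n.1 = Γ.gradedMonomial e ^ α := by
  obtain ⟨α, -, hα⟩ := exists_sub_smul_dual_mem he hen
  refine ⟨α, ?_⟩
  rw [gradedMonomial, gradedMonomial, AddMonoidAlgebra.single_pow, one_pow]
  congr 1
  apply Prod.ext
  · exact Γ.dualClass_eq_of_sub_mem (mem_lattice_iff.2 hα.1)
  · ext k
    have := hα.2 k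
    rw [Pi.sub_apply, sub_eq_zero] at this
    exact this

/-- The factor of a node of valency two in the orbifold graph is divisible by the factors of its
leaves. -/
theorem exists_pow_eq_mul_prod (n : Γ.Node) (hn : 2 ≤ Γ.orbValency n) {S : Finset V}
    (hS : ∀ e ∈ S, Γ.valency e = 1 ∧ Γ.Linked e n.1) :
    ∃ C ∈ supportedIn ℤ ((⊤ : AddSubmonoid Γ.H).prod Γ.innerCone),
      (1 - Γ.gradedMonomial n.1) ^ (Γ.valency n.1 - 2) =
        C * ∏ e ∈ S, (1 - Γ.gradedMonomial e) := by
  -- With orbifold valency at least two, at most `δ_n - 2` leaves hang at `n`. So each leaf gets its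
  -- own factor `1 - t^{E_n^*}`, divisible by `1 - t^{E_e^*}` since `t^{E_n^*}` is a power of
  -- `t^{E_e^*}`.
  have hcard := card_leaves_add_orbValency_le n S fun e he => ⟨(hS e he).1, (hS e he).2.symm⟩
  have hα : ∀ e ∈ S, ∃ α : ℕ, Γ.gradedMonomial n.1 = Γ.gradedMonomial e ^ α := fun e he =>
    exists_gradedMonomial_eq_pow (hS e he).1 (hS e he).2
  choose! α hα using hα
  refine ⟨(1 - Γ.gradedMonomial n.1) ^ (Γ.valency n.1 - 2 - S.card) *
    ∏ e ∈ S, ∑ k ∈ Finset.range (α e), Γ.gradedMonomial e ^ k, ?_, ?_⟩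
  · exact mul_mem (pow_mem (sub_mem (one_mem _) (gradedMonomial_mem_supportedIn _)) _)
      (prod_mem fun e _ => sum_mem fun k _ => pow_mem (gradedMonomial_mem_supportedIn _) _)
  · rw [mul_assoc, ← Finset.prod_mul_distrib]
    have : ∏ e ∈ S, ((∑ k ∈ Finset.range (α e), Γ.gradedMonomial e ^ k) *
        (1 - Γ.gradedMonomial e)) = (1 - Γ.gradedMonomial n.1) ^ S.card := by
      rw [Finset.prod_congr rfl fun e he => ?_, Finset.prod_const]
      rw [geom_sum_mul_neg, ← hα e he]
    rw [this, ← pow_add]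
    congr 1
    omega

/-- The structure of the reduced zeta function: its denominator only involves the leaves at the
end nodes of the orbifold graph. -/
theorem exists_isReducedZeta (hnode : Nonempty Γ.Node) (h : Γ.H) :
    ∃ (E : Finset V) (a : V → Γ.Node → ℚ) (B : LaurentPoly Γ.Node), B ∈ supportedIn ℤ Γ.innerCone ∧
      (∀ e ∈ E, (∀ n, 0 < a e n) ∧ -a e ∈ Γ.innerCone) ∧
      Γ.IsReducedZeta h (algebraMap (LaurentPoly Γ.Node) (RatFun Γ.Node) B /
        algebraMap (LaurentPoly Γ.Node) (RatFun Γ.Node) (∏ e ∈ E, oneSub (a e))) := by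
  classical
  obtain ⟨d, hd0, hd⟩ := Γ.exists_smul_dualClass_eq_zero
  have hnd : ∀ e ∈ Γ.leaves, ∃ n : Γ.Node, Γ.Linked e n.1 := fun e he =>
    exists_linked_node hnode (by rw [Γ.mem_leaves.1 he]; norm_num)
  have : Inhabited Γ.Node := Classical.inhabited_of_nonempty hnode
  choose! nd hnd using hnd
  -- The leaves in `M` hang at nodes of orbifold valency at least two and will cancel; those in `E`
  -- hang at end nodes and remain in the denominator.
  set M := Γ.leaves.filter fun e => 2 ≤ Γ.orbValency (nd e) with hM
  set E := Γ.leaves.filter fun e => ¬ 2 ≤ Γ.orbValency (nd e) with hE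
  set Q := supportedIn ℤ ((⊤ : AddSubmonoid Γ.H).prod Γ.innerCone) with hQ
  have hfac : ∀ v, ∃ C ∈ Q, (1 - Γ.gradedMonomial v) ^ (Γ.valency v - 2) =
      C * ∏ e ∈ M.filter (fun e => (nd e).1 = v), (1 - Γ.gradedMonomial e) := by
    intro v
    by_cases hne : (M.filter fun e => (nd e).1 = v).Nonempty
    · obtain ⟨e, he⟩ := hne
      rw [Finset.mem_filter] at he
      have he2 := (Finset.mem_filter.1 he.1).2
      rw [← he.2]
      refine exists_pow_eq_mul_prod (nd e) he2 fun e' he' => ?_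
      rw [Finset.mem_filter, hM, Finset.mem_filter] at he'
      exact ⟨Γ.mem_leaves.1 he'.1.1, he'.2 ▸ hnd e' he'.1.1⟩
    · rw [Finset.not_nonempty_iff_eq_empty] at hne
      rw [hne, Finset.prod_empty]
      exact ⟨_, pow_mem (sub_mem (one_mem _) (gradedMonomial_mem_supportedIn v)) _,
        (mul_one _).symm⟩
  choose C hCQ hC using hfac
  -- For `e ∈ M`, the factor `1 - t^{E_e^*}` taken from the node completes the geometric sum to `1 -
  -- t^{d E_e^*}`, which is of class zero and cancels against the denominator.
  have hnum : Γ.gradedReduce (Γ.zetaNum d) =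
      ((∏ v ∈ Γ.leavesᶜ, C v) * ∏ e ∈ E, ∑ k ∈ Finset.range d, Γ.gradedMonomial e ^ k) *
        classZero Γ.H (Γ.Node → ℚ) (∏ e ∈ M, oneSub (d • Γ.nodeExp e)) := by
    have h1 : ∏ v ∈ Γ.leavesᶜ, ∏ e ∈ M.filter (fun e => (nd e).1 = v), (1 - Γ.gradedMonomial e) =
        ∏ e ∈ M, (1 - Γ.gradedMonomial e) := by
      apply Finset.prod_fiberwise_of_maps_to
      intro e _
      rw [Finset.mem_compl, mem_leaves]
      have := (nd e).2
      omega
    have h2 : classZero Γ.H (Γ.Node → ℚ) (∏ e ∈ M, oneSub (d • Γ.nodeExp e)) =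
        ∏ e ∈ M, ((∑ k ∈ Finset.range d, Γ.gradedMonomial e ^ k) * (1 - Γ.gradedMonomial e)) := by
      rw [map_prod]
      refine Finset.prod_congr rfl fun e _ => ?_
      rw [geom_sum_mul_neg, one_sub_gradedMonomial_pow (hd e)]
    rw [gradedReduce_zetaNum, h2, Finset.prod_congr rfl fun v _ => hC v,
      Finset.prod_mul_distrib, h1,
      ← Finset.prod_filter_mul_prod_filter_not Γ.leaves (fun e => 2 ≤ Γ.orbValency (nd e)),
      Finset.prod_mul_distrib]
    ring
  have hpos : ∀ e n, 0 < (d • Γ.nodeExp e) n := fun e n => by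
    rw [Pi.smul_apply, nsmul_eq_mul]
    exact mul_pos (by exact_mod_cast hd0) (Γ.dual_pos e n.1)
  have hne : ∀ e, oneSub (d • Γ.nodeExp e) ≠ 0 := fun e h0 => by
    have := degreeIn_oneSub_nonneg (hpos e default)
    rw [h0, degreeIn_zero] at this
    simp at this
  refine ⟨E, fun e => d • Γ.nodeExp e, classPart h ((∏ v ∈ Γ.leavesᶜ, C v) *
    ∏ e ∈ E, ∑ k ∈ Finset.range d, Γ.gradedMonomial e ^ k), ?_, fun e he => ⟨hpos e, ?_⟩, ?_⟩
  · apply classPart_mem_supportedIn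
    exact mul_mem (prod_mem fun v _ => hCQ v)
      (prod_mem fun e _ => sum_mem fun k _ => pow_mem (gradedMonomial_mem_supportedIn _) _)
  · obtain ⟨he, he2⟩ := Finset.mem_filter.1 he
    rw [← smul_neg]
    exact AddSubmonoid.nsmul_mem _ (neg_nodeExp_mem_innerCone (Γ.mem_leaves.1 he) (hnd e he)
      (by omega)) d
  · have key := isReducedZeta_zetaDen hnode hd0 hd h
    rw [hnum, classPart_mul_classZero,
      ← Finset.prod_filter_mul_prod_filter_not Γ.leaves (fun e => 2 ≤ Γ.orbValency (nd e)),
      mul_comm (∏ e ∈ M, _), map_mul (algebraMap (LaurentPoly Γ.Node) (RatFun Γ.Node)),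
      map_mul (algebraMap (LaurentPoly Γ.Node) (RatFun Γ.Node)), mul_div_mul_right] at key
    · exact key
    · exact algebraMap_ratFun_ne_zero (Finset.prod_ne_zero_iff.2 fun e _ => hne e)

theorem isReducedZeta_reducedZeta (hnode : Nonempty Γ.Node) (h : Γ.H) :
    Γ.IsReducedZeta h (Γ.reducedZeta h) := by
  obtain ⟨E, a, B, -, -, hF⟩ := exists_isReducedZeta hnode h
  have hex : ∃ F, Γ.IsReducedZeta h F := ⟨_, hF⟩
  rw [reducedZeta, dif_pos hex]
  exact hex.choose_spec

theorem exists_hasNegDegreeIn_reducedZeta (hnode : Nonempty Γ.Node) (h : Γ.H) :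
    ∃ P ∈ supportedIn ℤ Γ.innerCone, ∀ n,
      HasNegDegreeIn n (Γ.reducedZeta h - algebraMap (LaurentPoly Γ.Node) (RatFun Γ.Node) P) := by
  obtain ⟨E, a, B, hB, ha, hF⟩ := exists_isReducedZeta hnode h
  rw [(isReducedZeta_reducedZeta hnode h).unique hnode hF]
  exact exists_hasNegDegreeIn_div_prod E (fun e he => (ha e he).1) (fun e he => (ha e he).2) hB

end PlumbingTree

end

/-! ### Comparison of coefficients -/

/-- If the orbifold graph is a bamboo, then `P_h = P_h^+` for all `h ∈ H`, and every monomial of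
`P_h^+` has multiplicity one. The first two conjuncts say that the objects involved (the reduced
zeta function and all the decompositions) exist and are unique. -/
theorem mainTheorem3 {V : Type*} [Fintype V] [DecidableEq V] (Γ : PlumbingTree V)
    (hnode : Nonempty Γ.Node) (hbamboo : Γ.OrbIsBamboo) (h : Γ.H) :
    (∃! F : RatFun Γ.Node, Γ.IsReducedZeta h F) ∧
    (∀ S : Set Γ.Node, S.Nonempty →
      ∃! P : LaurentPoly Γ.Node, IsPolyPart S (Γ.reducedZeta h) P) ∧
    Γ.polynomialPart h = Γ.quotientPart h ∧
    ∀ β ∈ (Γ.quotientPart h).coeff.support, ∀ n₀ : Γ.Node, Γ.multiplicity n₀ β = 1 := by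
  classical
  obtain ⟨P, hP, hneg⟩ := PlumbingTree.exists_hasNegDegreeIn_reducedZeta hnode h
  have hpart : ∀ S : Set Γ.Node, IsPolyPart S (Γ.reducedZeta h)
      (filterTerms (fun β => ∃ i ∈ S, 0 ≤ β i) P) := fun S => by
    convert isPolyPart_filterTerms (S := S) fun i _ => hneg i
  have hcoeff : ∀ (S : Set Γ.Node), S.Nonempty → ∀ β, (polyPart S (Γ.reducedZeta h)).coeff β =
      if ∃ i ∈ S, 0 ≤ β i then P.coeff β else 0 := fun S hS β => by
    rw [polyPart_eq hS (hpart S), coeff_filterTerms]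
  have hquot : ∀ β, (Γ.quotientPart h).coeff β = if ∃ i, 0 ≤ β i then P.coeff β else 0 :=
    fun β => by
      rw [PlumbingTree.quotientPart, hcoeff _ Set.univ_nonempty]
      simp
  have hconn : ∀ β ∈ P.coeff.support, (Γ.orbGraph.induce {n | 0 ≤ β n}).Preconnected :=
    fun β hβ => PlumbingTree.preconnected_induce_nonneg hnode hbamboo (hP β hβ)
  refine ⟨⟨_, PlumbingTree.isReducedZeta_reducedZeta hnode h, fun F hF =>
    hF.unique hnode (PlumbingTree.isReducedZeta_reducedZeta hnode h)⟩, fun S hS =>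
    ⟨_, hpart S, fun P' hP' => hP'.unique hS (hpart S)⟩, ?_, ?_⟩
  · apply AddMonoidAlgebra.ext
    ext β
    have hedge : ∀ e : Sym2 Γ.Node, (polyPart {n | n ∈ e} (Γ.reducedZeta h)).coeff β =
        (if ∃ n ∈ e, 0 ≤ β n then 1 else 0) * P.coeff β := by
      intro e
      rw [hcoeff _ (by induction e with | h x y => exact ⟨x, by simp⟩), ite_mul, one_mul, zero_mul]
      congr!
    have hvert : ∀ n : Γ.Node, ((Γ.orbValency n : ℤ) - 1) *
        (polyPart {n} (Γ.reducedZeta h)).coeff β =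
        (if 0 ≤ β n then (Γ.orbValency n : ℤ) - 1 else 0) * P.coeff β := by
      intro n
      rw [hcoeff _ (Set.singleton_nonempty n)]
      simp
    have hsum : (Γ.polynomialPart h).coeff β =
        ((∑ e ∈ Γ.orbGraph.edgeFinset, if ∃ n ∈ e, 0 ≤ β n then 1 else 0 : ℤ) -
          (∑ n : Γ.Node, if 0 ≤ β n then (Γ.orbValency n : ℤ) - 1 else 0)) * P.coeff β := by
      rw [PlumbingTree.polynomialPart, AddMonoidAlgebra.coeff_sub, Finsupp.sub_apply,
        AddMonoidAlgebra.coeff_sum, AddMonoidAlgebra.coeff_sum, Finsupp.finsetSum_apply,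
        Finsupp.finsetSum_apply, sub_mul, Finset.sum_mul, Finset.sum_mul]
      congr 1
      · refine Finset.sum_congr (by congr!) fun e _ => hedge e
      · refine Finset.sum_congr rfl fun n _ => ?_
        rw [← hvert, AddMonoidAlgebra.coeff_smul, Finsupp.smul_apply, smul_eq_mul]
    rw [hsum, hquot]
    -- Connectedness is known only for exponents of `P`; elsewhere both coefficients vanish. They
    -- also vanish when all coordinates are negative, since `β` then enters no polynomial part.
    by_cases h0 : P.coeff β = 0
    · simp [h0]
    · by_cases hβ : ∃ i, 0 ≤ β i
      · have := PlumbingTree.card_edges_sub_sum hnode hβ (hconn β (Finsupp.mem_support_iff.2 h0))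
        rw [if_pos hβ]
        conv_rhs => rw [← one_mul (P.coeff β), ← this]
      · rw [if_neg hβ]
        push Not at hβ
        have h1 : ∀ n, ¬ 0 ≤ β n := fun n => not_le.2 (hβ n)
        simp [h1]
  · intro β hβ n₀
    rw [Finsupp.mem_support_iff, hquot, ne_eq, ite_eq_right_iff, Classical.not_imp] at hβ
    exact PlumbingTree.multiplicity_eq_one hnode hβ.1 (hconn β (Finsupp.mem_support_iff.2 hβ.2)) n₀
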